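/- **Setting.** There are $m$ sets with costs $1/C \le c_s \le 1$, where $C \ge 1$, and the universe $\mathcal E$ is initially empty. An update inserts a new element, given by the list of the sets that contain it (at least one and at most $f$), or deletes an element that is present; at most $n$ elements are ever present at the same time. Let $0<\varepsilon<1/2$, suppose $Cn \ge 1+\varepsilon$ (this is automatic if $n\ge 2$), and put $L=\lceil \log_{1+\varepsilon}(Cn)\rceil+1$. **The algorithm.** Every set $s$ has a level $\ell(s)$ (initially $0$) and an element $e$ has the level $\ell(e)=\max\{\ell(s): e\in s\}$. The present elements are active or passive; deleted elements are kept as dead elements until they are removed by a rebuild. Each element that is kept has a weight $w(e)$, and $W^*(s)$ is the total weight of the active, passive and dead elements of $s$. The set $s$ is tight if $c_s/(1+\varepsilon)\le W^*(s)\le c_s$; the maintained output is the collection of tight sets. Let $\mathcal E_{\le k}$, $A_{\le k}$, $P_{\le k}$, $D_{\le k}$ be the sets of the present, active, passive and dead elements at levels $\le k$. There is a counter $\mathcal C_{\le k}$, initially $0$, for every level $k\in\{0,\dots,L\}$. * *Insertion of $e$*: $e$ becomes passive, with weight $0$ if a set containing $e$ is tight, and otherwise with weight $\lambda=\min\{c_s-W^*(s):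 e\in s\}$. * *Deletion of $e$*: $e$ becomes dead, keeping its level and weight. For $k=L,L-1,\dots,\ell(e)$: decrease $\mathcal C_{\le k}$ by $1$; if now $\mathcal C_{\le k}\le 0$, call Rebuild($\le k$) and stop. * *Rebuild($\le k$)*: Let $\mathcal S'$ be the collection of the sets at level $\le k$ that contain an element of $\mathcal E_{\le k}\cup D_{\le k}$. Remove the elements of $D_{\le k}$. Move all sets of $\mathcal S'$ to level $k+1$, give the elements that were in $A_{\le k}$ the weight $(1+\varepsilon)^{-(k+1)}$ and those that were in $P_{\le k}$ the weight $0$. Then treat the latter one by one: if $W^*(s)\le c_s-(1+\varepsilon)^{-(k+1)}$ for all sets $s$ containing $e$, then $e$ becomes active with weight $(1+\varepsilon)^{-(k+1)}$; otherwise its weight becomes $\min\{c_s-W^*(s): e\in s\}$ and it remains passive. Now move the sets of $\mathcal S'$ that are not tight down to level $k$; the elements that thereby arrive at level $k$ are active and get weight $(1+\varepsilon)^{-k}$. All these sets and elements are alive. For $i=k,k-1,\dots,0$, as long as there is an alive set with target level $i$, choose one, move it and its alive elements to level $i$, give these elements the weight $(1+\varepsilon)^{-i}$, and make the set and these elements frozen.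 Here, in round $i$, the target level of an alive set $s$ that contains $a$ alive elements is $0$ if $a=0$, and otherwise the largest $j\in\{1,\dots,i\}$ with $W^*(s)+\big((1+\varepsilon)^{-j}-(1+\varepsilon)^{-k}\big)a\ge c_s/(1+\varepsilon)$ ($0$ if there is none). Finally put $\mathcal C_{\le j}=\varepsilon|\mathcal E_{\le j}|$ for all $j\le k$. Time is the number of elementary steps of an implementation of this algorithm (with arrays and doubly linked lists, including the maintenance of the output) on a pointer machine with real-number registers, on which arithmetic, comparisons, logarithms and rounding down cost one step; the preprocessing is not counted. **Theorem.** The dynamic algorithm has amortized update time $O(f\log(Cn)/\varepsilon^2)$: there is an absolute constant $K>0$ such that, in the above setting, for every legal sequence of updates and every $t$, the total time spent on the first $t$ updates is at most $K\cdot\frac{f\log(Cn)}{\varepsilon^2}\cdot t$. Moreover $L\le K\log(Cn)/\varepsilon$, and every update that calls Rebuild($\le k$) (where $k \le L$) takes time at most $$K\Big(\frac f\varepsilon\, d+f\, i+\frac{\log(Cn)}{\varepsilon}\Big),$$ where $d$ is the number of elements deleted from, and $i$ the number of elements inserted at, levels $\le k$ since the previous call of Rebuild($\le j$) with some $j\ge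 k$ (since the beginning if there was none), the present update included. -/

import Mathlib

/-! Dynamic set cover: a step-counted implementation of the hierarchical-partition algorithm.

Cost model: a real-number random-access machine with pointers. A program is a function that takes
the store to a result, a new store and the number of elementary steps executed. The store is only
accessed through `query` and `act`, which cost one step and which are applied below only to accesses
that touch a bounded number of cells (array cells, real arithmetic, comparisons, logarithm and
floor, the head and the length of a doubly linked list, insertion into and removal from such a list
through a pointer). Lists are read one entry per step, by the loops. Each test of a loop
condition costs one step. -/

noncomputable section

namespace DynamicSetCover

/-- The fixed data of an instance: the costs of the `m` sets, the cost parameter `C`, the upper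
bound `n` on the number of elements that are simultaneously present, and the accuracy `ε`. -/
structure Params (m : ℕ) where
  cost : Fin m → ℝ
  C : ℝ
  n : ℕ
  ε : ℝ

/-- The top level `L = ⌈log_{1+ε} (C n)⌉ + 1`. -/
def Params.L {m : ℕ} (p : Params m) : ℕ := ⌈Real.logb (1 + p.ε) (p.C * p.n)⌉₊ + 1

/-- The weight `(1+ε)^{-i}` of an active element at level `i`. -/
def Params.lw {m : ℕ} (p : Params m) (i : ℕ) : ℝ := ((1 + p.ε) ^ i)⁻¹

/-- The set `s` is tight when its weight is `x`. -/
def Params.isTight {m : ℕ} (p : Params m) (s : Fin m) (x : ℝ) : Bool :=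
  decide ((1 + p.ε)⁻¹ * p.cost s ≤ x ∧ x ≤ p.cost s)

/-- The three states of an element. -/
inductive Status where
  | active
  | passive
  | dead
  deriving DecidableEq

/-- The store. Elements are named by natural numbers, in the order of their insertion. -/
structure Store (m : ℕ) where
  /-- the level `ℓ(s)` of a set -/
  slevel : Fin m → ℕ
  /-- the weight `W*(s)` of a set, dead elements included -/
  W : Fin m → ℝ
  /-- the name of the next element -/
  next : ℕ
  /-- the list of the sets that contain an element -/
  sets : ℕ → List (Fin m)
  /-- the level `ℓ(e)` of an element -/
  elevel : ℕ → ℕ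
  /-- the weight `w(e)` of an element -/
  w : ℕ → ℝ
  /-- the state of an element -/
  status : ℕ → Status
  /-- the doubly linked lists `A_i`, `P_i`, `D_i` -/
  list : Status → ℕ → List ℕ
  /-- the counters `C_{≤ i}` -/
  counter : ℕ → ℝ
  /-- the maintained set cover: the sets that are tight with respect to `W*` -/
  cover : Finset (Fin m)
  /-- the additions to (`true`) and removals from (`false`) the cover during the current update -/
  report : List (Fin m × Bool)
  /-- scratch: has the set been found by the current rebuild? -/
  found : Fin m → Bool
  /-- scratch: is the set alive in the level-fixing phase? -/
  setAlive : Fin m → Bool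
  /-- scratch: is the element alive in the level-fixing phase? -/
  eltAlive : ℕ → Bool
  /-- scratch: the elements of the level-fixing phase that belong to a set -/
  members : Fin m → List ℕ
  /-- scratch: the number of alive elements in a set -/
  aliveCount : Fin m → ℕ
  /-- scratch: the current target level of an alive set -/
  target : Fin m → ℕ
  /-- scratch: the doubly linked lists `Γ[i]` of the alive sets with target level `i` -/
  bucket : ℕ → List (Fin m)

/-- The store after preprocessing: `m` empty sets, no elements, every set at level `0`. -/
def Store.init (m : ℕ) : Store m where
  slevel := fun _ => 0
  W := fun _ => 0
  next := 0
  sets := fun _ => []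
  elevel := fun _ => 0
  w := fun _ => 0
  status := fun _ => Status.dead
  list := fun _ _ => []
  counter := fun _ => 0
  cover := ∅
  report := []
  found := fun _ => false
  setAlive := fun _ => false
  eltAlive := fun _ => false
  members := fun _ => []
  aliveCount := fun _ => 0
  target := fun _ => 0
  bucket := fun _ => []

/-! ### Programs with a step count -/

/-- A program: result, final store, number of steps (`⊤` for a loop that does not stop). -/
def Prog (m : ℕ) (α : Type) : Type := Store m → α × Store m × ℕ∞

instance (m : ℕ) : Monad (Prog m) where
  pure a := fun σ => (a, σ, 0)
  bind x g := fun σ =>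
    let r := x σ
    let q := g r.1 r.2.1
    (q.1, q.2.1, r.2.2 + q.2.2)

section combinators

variable {m : ℕ} {α β : Type}

/-- An elementary access that returns a value. -/
def query (g : Store m → α) : Prog m α := fun σ => (g σ, σ, 1)

/-- An elementary access that changes the store. -/
def act (g : Store m → Store m) : Prog m Unit := fun σ => ((), g σ, 1)

/-- One elementary step without effect on the store. -/
def tick : Prog m Unit := act id

/-- A non-terminating run. -/
def diverge : Prog m Unit := fun σ => ((), σ, ⊤)

/-- Loop through a list, carrying along a value. -/
def foldLoop (g : β → α → Prog m β) : List α → β → Prog m β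
  | [], b => do
      tick
      pure b
  | a :: l, b => do
      tick
      let b' ← g b a
      foldLoop g l b'

/-- Loop through a list. -/
def each (l : List α) (g : α → Prog m Unit) : Prog m Unit :=
  foldLoop (fun _ a => g a) l ()

/-- `while cond do body`. The first argument bounds the number of evaluations of the condition; if
the loop has not stopped by then, the run counts as non-terminating, so that a finite step count
certifies that the loop was executed in full. -/
def whileLoop (cond : Store m → Bool) (body : Prog m Unit) : ℕ → Prog m Unit
  | 0 => diverge
  | N + 1 => do
      let b ← query cond
      if b then do
        body
        whileLoop cond body N
      else pure ()

end combinators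

/-! ### Elementary changes of the store -/

namespace Store

variable {m : ℕ}

/-- `W*(s) ← W*(s) + x`; the maintained cover is corrected accordingly. -/
def addW (p : Params m) (s : Fin m) (x : ℝ) (σ : Store m) : Store m :=
  let b := p.isTight s (σ.W s + x)
  { σ with
    W := Function.update σ.W s (σ.W s + x)
    cover := if b then insert s σ.cover else σ.cover.erase s
    report := if b = decide (s ∈ σ.cover) then σ.report else (s, b) :: σ.report }

/-- `ℓ(s) ← i`. -/
def setLevel (s : Fin m) (i : ℕ) (σ : Store m) : Store m :=
  { σ with slevel := Function.update σ.slevel s i }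

/-- `w(e) ← x`. -/
def setw (e : ℕ) (x : ℝ) (σ : Store m) : Store m :=
  { σ with w := Function.update σ.w e x }

/-- Replace one of the lists `A_i`, `P_i`, `D_i`. -/
def setList (st : Status) (i : ℕ) (l : List ℕ) (σ : Store m) : Store m :=
  { σ with list := Function.update σ.list st (Function.update (σ.list st) i l) }

/-- Take the element out of the list that it is in. -/
def unlink (e : ℕ) (σ : Store m) : Store m :=
  σ.setList (σ.status e) (σ.elevel e) ((σ.list (σ.status e) (σ.elevel e)).erase e)

/-- Give an element, which is in no list, a state and a level, and put it into the right list. -/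
def link (e : ℕ) (st : Status) (i : ℕ) (σ : Store m) : Store m :=
  { σ.setList st i (e :: σ.list st i) with
    status := Function.update σ.status e st
    elevel := Function.update σ.elevel e i }

/-- Change the state and the level of an element. -/
def move (e : ℕ) (st : Status) (i : ℕ) (σ : Store m) : Store m :=
  (σ.unlink e).link e st i

/-- Reserve a name for a new element. -/
def reserve (σ : Store m) : Store m :=
  { σ with next := σ.next + 1 }

/-- Add `s` to the list of the sets that contain `e`. -/
def addIncidence (e : ℕ) (s : Fin m) (σ : Store m) : Store m :=
  { σ with sets := Function.update σ.sets e (s :: σ.sets e) }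

/-- `C_{≤ k} ← x`. -/
def setCounter (k : ℕ) (x : ℝ) (σ : Store m) : Store m :=
  { σ with counter := Function.update σ.counter k x }

def clearReport (σ : Store m) : Store m :=
  { σ with report := [] }

def setFound (s : Fin m) (b : Bool) (σ : Store m) : Store m :=
  { σ with found := Function.update σ.found s b }

/-- Declare a set alive, without any alive elements so far. -/
def openSet (s : Fin m) (σ : Store m) : Store m :=
  { σ with
    setAlive := Function.update σ.setAlive s true
    members := Function.update σ.members s []
    aliveCount := Function.update σ.aliveCount s 0 }

def setEltAlive (e : ℕ) (b : Bool) (σ : Store m) : Store m :=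
  { σ with eltAlive := Function.update σ.eltAlive e b }

/-- Record the alive element `e` of the alive set `s`. -/
def addMember (s : Fin m) (e : ℕ) (σ : Store m) : Store m :=
  { σ with
    members := Function.update σ.members s (e :: σ.members s)
    aliveCount := Function.update σ.aliveCount s (σ.aliveCount s + 1) }

def decAlive (s : Fin m) (σ : Store m) : Store m :=
  { σ with aliveCount := Function.update σ.aliveCount s (σ.aliveCount s - 1) }

def setBucket (i : ℕ) (l : List (Fin m)) (σ : Store m) : Store m :=
  { σ with bucket := Function.update σ.bucket i l }

/-- Take an alive set out of its bucket. -/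
def unbucket (s : Fin m) (σ : Store m) : Store m :=
  σ.setBucket (σ.target s) ((σ.bucket (σ.target s)).erase s)

/-- Set the target level of an alive set, which is in no bucket, and put it into the right one. -/
def enbucket (s : Fin m) (i : ℕ) (σ : Store m) : Store m :=
  { σ.setBucket i (s :: σ.bucket i) with target := Function.update σ.target s i }

/-- Take an alive set out of its bucket and make it frozen. -/
def freezeSet (s : Fin m) (σ : Store m) : Store m :=
  { σ.unbucket s with setAlive := Function.update σ.setAlive s false }

/-- The target level of a set in the level-fixing phase of a rebuild of the levels `≤ k`, while the
sets are being moved to level `i ≤ k`: it is `0` if the set has no alive element, and otherwise the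
largest level `j ∈ [1, i]` such that the set would have weight at least `c_s / (1+ε)` if all its
alive elements, which have weight `(1+ε)^{-k}` now, had weight `(1+ε)^{-j}`
(and `0` if there is no such level). -/
def targetLevel (p : Params m) (k i : ℕ) (s : Fin m) (σ : Store m) : ℕ :=
  if σ.aliveCount s = 0 then 0
  else Nat.findGreatest
    (fun j => p.cost s / (1 + p.ε) ≤ σ.W s + (p.lw j - p.lw k) * (σ.aliveCount s : ℝ)) i

end Store

/-- Why a target level can be found in a bounded number of steps: the search in its definition has
a closed form (take `a = |s ∩ E'_alive|` and `x = c_s / (1+ε) - W*(s) + a (1+ε)^{-k}`). -/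
theorem findGreatest_closed_form (ε a x : ℝ) (hε : 0 < ε) (ha : 0 < a) (N : ℕ) :
    Nat.findGreatest (fun j => x ≤ a * ((1 + ε) ^ j)⁻¹) N =
      if x ≤ 0 then N else min N ⌊Real.logb (1 + ε) (a / x)⌋₊ := by
  have h1 : (1 : ℝ) < 1 + ε := by linarith
  split_ifs with hx
  · rw [Nat.findGreatest_eq_iff]
    refine ⟨le_rfl, fun _ => le_trans hx (by positivity), fun n h h' => ?_⟩
    omega
  · have hx : 0 < x := not_le.mp hx
    have key : ∀ j : ℕ, x ≤ a * ((1 + ε) ^ j)⁻¹ ↔ (j : ℝ) ≤ Real.logb (1 + ε) (a / x) := by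
      intro j
      rw [Real.le_logb_iff_rpow_le h1 (by positivity), Real.rpow_natCast, le_div_iff₀ hx,
        ← div_eq_mul_inv, le_div_iff₀ (by positivity), mul_comm]
    have key2 : ∀ j : ℕ, j ≠ 0 →
        (x ≤ a * ((1 + ε) ^ j)⁻¹ ↔ j ≤ ⌊Real.logb (1 + ε) (a / x)⌋₊) := by
      intro j hj
      rw [key, Nat.le_floor_iff' hj]
    rw [Nat.findGreatest_eq_iff]
    refine ⟨min_le_left _ _, fun h => (key2 _ h).2 (min_le_right _ _), fun n h h' h'' => ?_⟩
    have := (key2 n (by omega)).1 h''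
    omega

/-! ### Auxiliary programs -/

section programs

variable {m : ℕ} (p : Params m)

/-- The largest level of the sets in a list. -/
def maxLevel (F : List (Fin m)) : Prog m ℕ :=
  foldLoop (fun b s => query (fun σ => max b (σ.slevel s))) F 0

/-- Is one of the sets in the list tight? -/
def someTight (F : List (Fin m)) : Prog m Bool :=
  foldLoop (fun b s => query (fun σ => b || p.isTight s (σ.W s))) F false

/-- Can the weight of all the sets in the list grow by `x`? -/
def allHaveRoom (x : ℝ) (F : List (Fin m)) : Prog m Bool :=
  foldLoop (fun b s => query (fun σ => b && decide (σ.W s ≤ p.cost s - x))) F true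

/-- The least `x` such that `W*(s) + x = c_s` for one of the sets `s` in the list. -/
def leastSlack : List (Fin m) → Prog m ℝ
  | [] => pure 0
  | s :: F => do
      let x ← query (fun σ => p.cost s - σ.W s)
      foldLoop (fun b s' => query (fun σ => min b (p.cost s' - σ.W s'))) F x

/-- Change the weight of an element, together with the weights of the sets that contain it. -/
def reweigh (e : ℕ) (x : ℝ) : Prog m Unit := do
  let y ← query (fun σ => σ.w e)
  act (Store.setw e x)
  let F ← query (fun σ => σ.sets e)
  each F (fun s => act (Store.addW p s (x - y)))

/-- List the elements at levels `≤ k` that are in a given state. -/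
def collect (st : Status) (k : ℕ) : Prog m (List ℕ) :=
  foldLoop (fun acc i => do
    let l ← query (fun σ => σ.list st i)
    foldLoop (fun acc e => do
      tick
      pure (e :: acc)) l acc) (List.range (k + 1)) []

/-! ### Fixing the levels `≤ k` -/

/-- Recompute the target level of an alive set and move it to the right bucket. -/
def retarget (k i : ℕ) (s : Fin m) : Prog m Unit := do
  let j ← query (Store.targetLevel p k i s)
  act (Store.unbucket s)
  act (Store.enbucket s j)

/-- Freeze an alive element at level `i`. -/
def freezeElement (k i : ℕ) (e : ℕ) : Prog m Unit := do
  act (Store.move e Status.active i)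
  act (Store.setw e (p.lw i))
  act (Store.setEltAlive e false)
  let F ← query (fun σ => σ.sets e)
  each F (fun s => do
    act (Store.addW p s (p.lw i - p.lw k))
    let b ← query (fun σ => σ.setAlive s)
    if b then do
      act (Store.decAlive s)
      retarget p k i s
    else pure ())

/-- One iteration in round `i`: a set with the largest target level is moved to that level and
frozen, along with its alive elements. -/
def freezeNext (k i : ℕ) : Prog m Unit := do
  let l ← query (fun σ => σ.bucket i)
  match l with
  | [] => pure ()
  | s :: _ => do
      act (Store.freezeSet s)
      act (Store.setLevel s i)
      let es ← query (fun σ => σ.members s)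
      each es (fun e => do
        let b ← query (fun σ => σ.eltAlive e)
        if b then freezeElement p k i e else pure ())

/-- Fix the levels of the sets in `S'` and of the elements in `E'`, all of which are at level `k`.
A round makes at most `m` iterations, because each of them freezes a set. -/
def fixLevels (k : ℕ) (S' : List (Fin m)) (E' : List ℕ) : Prog m Unit := do
  each (List.range (k + 1)) (fun i => act (Store.setBucket i []))
  each S' (fun s => act (Store.openSet s))
  each E' (fun e => do
    act (Store.setEltAlive e true)
    let F ← query (fun σ => σ.sets e)
    each F (fun s => act (Store.addMember s e)))
  each S' (fun s => do
    let j ← query (Store.targetLevel p k k s)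
    act (Store.enbucket s j))
  each (List.range (k + 1)).reverse (fun i =>
    whileLoop (fun σ => !(σ.bucket i).isEmpty) (freezeNext p k i) (m + 1))

/-! ### Rebuilding the levels `≤ k` -/

/-- For a list of elements, the sets at level `≤ k` that contain one of them and are not yet
in the given list. -/
def findSets (k : ℕ) (es : List ℕ) (S' : List (Fin m)) : Prog m (List (Fin m)) :=
  foldLoop (fun acc e => do
    let F ← query (fun σ => σ.sets e)
    foldLoop (fun acc s => do
      let b ← query (fun σ => decide (σ.slevel s ≤ k) && !σ.found s)
      if b then do
        act (Store.setFound s true)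
        pure (s :: acc)
      else pure acc) F acc) es S'

/-- The new weight and state of an element at level `k + 1` that was passive. -/
def settlePassive (k : ℕ) (e : ℕ) : Prog m Unit := do
  let F ← query (fun σ => σ.sets e)
  let b ← allHaveRoom p (p.lw (k + 1)) F
  if b then do
    reweigh p e (p.lw (k + 1))
    act (Store.move e Status.active (k + 1))
  else do
    let x ← leastSlack p F
    reweigh p e x

/-- Move the sets that are not tight down to level `k`, and list them. -/
def lowerSets (k : ℕ) (S' : List (Fin m)) : Prog m (List (Fin m)) :=
  foldLoop (fun acc s => do
    let b ← query (fun σ => p.isTight s (σ.W s))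
    if b then pure acc
    else do
      act (Store.setLevel s k)
      pure (s :: acc)) S' []

/-- The elements all of whose sets have been moved down to level `k` move down
with them; they are added to the given list. -/
def lowerElements (k : ℕ) (es : List ℕ) (E' : List ℕ) : Prog m (List ℕ) :=
  foldLoop (fun acc e => do
    let F ← query (fun σ => σ.sets e)
    let i ← maxLevel F
    if i ≤ k then do
      act (Store.move e Status.active k)
      reweigh p e (p.lw k)
      pure (e :: acc)
    else pure acc) es E'

/-- `C_{≤ j} ← ε |E_{≤ j}|` for all `j ≤ k`. -/
def resetCounters (k : ℕ) : Prog m Unit := do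
  let _ ← foldLoop (fun (N : ℕ) j => do
    let N' ← query (fun σ =>
      N + (σ.list Status.active j).length + (σ.list Status.passive j).length)
    act (Store.setCounter j (p.ε * (N' : ℝ)))
    pure N') (List.range (k + 1)) 0
  pure ()

/-- The subroutine `Rebuild(≤ k)`. -/
def rebuild (k : ℕ) : Prog m Unit := do
  let as ← collect Status.active k
  let ps ← collect Status.passive k
  let ds ← collect Status.dead k
  -- the sets affected by the rebuild
  let S₁ ← findSets k as []
  let S₂ ← findSets k ps S₁
  let S' ← findSets k ds S₂
  -- forget the dead elements
  each ds (fun e => do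
    reweigh p e 0
    act (Store.unlink e))
  -- everything moves up to level `k + 1`
  each ps (fun e => reweigh p e 0)
  each S' (fun s => act (Store.setLevel s (k + 1)))
  each ps (fun e => act (Store.move e Status.passive (k + 1)))
  each as (fun e => do
    act (Store.move e Status.active (k + 1))
    reweigh p e (p.lw (k + 1)))
  -- passive elements become active if there is room for that
  each ps (fun e => settlePassive p k e)
  -- what is not tight moves down to level `k`
  let S'' ← lowerSets p k S'
  let E₁ ← lowerElements p k as []
  let E' ← lowerElements p k ps E₁
  -- distribute it over the levels `0, …, k`
  fixLevels p k S'' E'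
  -- restart the counters
  resetCounters p k
  each S' (fun s => act (Store.setFound s false))

/-! ### The updates -/

/-- The loop of a deletion: the counters of the given levels are decremented one after the other,
until one of them is used up and the levels up to it are rebuilt. The result is the level `k` for
which `Rebuild(≤ k)` was called, if any. -/
def countDown : List ℕ → Prog m (Option ℕ)
  | [] => pure none
  | k :: ks => do
      let x ← query (fun σ => σ.counter k)
      act (Store.setCounter k (x - 1))
      if x - 1 ≤ 0 then do
        rebuild p k
        pure (some k)
      else countDown ks

/-- Deletion of an element. -/
def deleteElement (e : ℕ) : Prog m (Option ℕ) := do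
  let i ← query (fun σ => σ.elevel e)
  act (Store.move e Status.dead i)
  countDown p (List.range' i (p.L + 1 - i)).reverse

/-- Insertion of a new element that belongs to the given sets. -/
def insertElement (F : List (Fin m)) : Prog m (Option ℕ) := do
  let e ← query (fun σ => σ.next)
  act Store.reserve
  each F (fun s => act (Store.addIncidence e s))
  let i ← maxLevel F
  let b ← someTight p F
  if b then do
    act (Store.link e Status.passive i)
    act (Store.setw e 0)
    pure none
  else do
    let x ← leastSlack p F
    act (Store.link e Status.passive i)
    act (Store.setw e x)
    each F (fun s => act (Store.addW p s x))
    pure none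

end programs

/-- An update of the input: insertion of a new element, given by the sets that contain it, or
deletion of the element with the given name. The `j`-th insertion (`j = 0, 1, …`) creates the
element with the name `j`. -/
inductive Update (m : ℕ) where
  | insert (F : List (Fin m))
  | delete (e : ℕ)

section execution

variable {m : ℕ} (p : Params m)

/-- The processing of an update; the result is the level `k` for which `Rebuild(≤ k)` was called,
if any. -/
def process (u : Update m) : Prog m (Option ℕ) := do
  act Store.clearReport
  match u with
  | Update.insert F => insertElement p F
  | Update.delete e => deleteElement p e

/-- The processing of a sequence of updates. -/
def processAll : List (Update m) → Prog m Unit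
  | [] => pure ()
  | u :: us => do
      let _ ← process p u
      processAll us

/-- The number of steps spent on a sequence of updates, starting after preprocessing. -/
def totalTime (us : List (Update m)) : ℕ∞ := (processAll p us (Store.init m)).2.2

/-- The store just before the update `us[i]`. -/
def storeBefore (us : List (Update m)) (i : ℕ) : Store m :=
  (processAll p (us.take i) (Store.init m)).2.1

/-- The level `k` for which `Rebuild(≤ k)` is called during the update `us[i]`, if any. -/
def rebuildLevel (us : List (Update m)) (i : ℕ) : Option ℕ :=
  us[i]?.bind (fun u => (process p u (storeBefore p us i)).1)

/-- The number of steps spent on the update `us[i]`. -/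
def updateTime (us : List (Update m)) (i : ℕ) : ℕ∞ :=
  us[i]?.elim 0 (fun u => (process p u (storeBefore p us i)).2.2)

/-- `us[i]` is the deletion of an element that is at a level `≤ k` at that time. -/
def DeletesAtMost (us : List (Update m)) (k i : ℕ) : Prop :=
  ∃ e, us[i]? = some (Update.delete e) ∧ (storeBefore p us i).elevel e ≤ k

/-- `us[i]` is the insertion of an element at a level `≤ k`. -/
def InsertsAtMost (us : List (Update m)) (k i : ℕ) : Prop :=
  ∃ F, us[i]? = some (Update.insert F) ∧ ∀ s ∈ F, (storeBefore p us i).slevel s ≤ k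

/-- The updates since the last rebuild, before the update `us[t]`, of the levels `≤ j` for some
`j ≥ k` (since the beginning if there was none); the update `us[t]` is included. -/
def window (us : List (Update m)) (k t : ℕ) : Set ℕ :=
  {i | i ≤ t ∧ ∀ r, i ≤ r → r < t → ∀ j, rebuildLevel p us r = some j → j < k}

end execution

/-- The elements that are present after a sequence of updates, with the number of insertions. -/
def present {m : ℕ} (us : List (Update m)) : ℕ × Finset ℕ :=
  us.foldl (fun q u =>
    match u with
    | Update.insert _ => (q.1 + 1, insert q.1 q.2)
    | Update.delete e => (q.1, q.2.erase e)) (0, ∅)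

/-- A legal sequence of updates: every inserted element belongs to at least one and at most `f`
sets, only elements that are present are deleted, and there are never more than `n` elements. -/
structure Legal {m : ℕ} (f n : ℕ) (us : List (Update m)) : Prop where
  insert_ok : ∀ F, Update.insert F ∈ us → F ≠ [] ∧ F.Nodup ∧ F.length ≤ f
  delete_ok : ∀ i e, us[i]? = some (Update.delete e) → e ∈ (present (us.take i)).2
  size_ok : ∀ i, (present (us.take i)).2.card ≤ n

end DynamicSetCover

end

/-! The running time depends only on the lists of elements and on the counters, never on weights or
tightness. Call the elements at levels ≤ k, dead ones included, the kept elements, and let N_k be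
their number. The whole analysis rests on the excess N_k - C_{≤k}/ε, one number per level
(`excess`).

A rebuild of the levels ≤ j brings the excess of every k ≤ j to 0: it removes the dead elements
there and sets C_{≤k} = ε N_k. A rebuild of the levels ≤ j with j < k leaves C_{≤k} alone and moves
elements only within the levels ≤ j+1 ≤ k, so the excess of k does not grow. An insertion at a level
≤ k adds at most 1, and a deletion at a level ≤ k adds at most 1 + 1/ε, because it takes 1 off the
counter (`load`). When Rebuild(≤ k) is called, its counter is at most 0, so N_k is at most the
excess of k plus the load of the current update.

Rebuild(≤ k) costs O(f N_k + k) by `wp_rebuild`: each phase spends O(f) per element, and at most f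
N_k sets are involved. Level fixing is paid by a potential: an alive set holds the price of scanning
its members and an alive element the price of being frozen; both are frozen at most once
(`Fixing.freezeElement`, `Fixing.freezeNext`).

Everything about a single update is collected in `UpdateSpec`. Summing the loads since the last
rebuild of the levels ≤ j with j ≥ k bounds the individual rebuilds (`Legal.excess_add_load_le`).
For the amortized bound the potential is 100 f times the sum over all levels of the positive parts
of the excesses: an update raises each of the L+1 terms by at most 1 + 1/ε, and a rebuild of the
levels ≤ k is paid by the term of k, which vanishes (`UpdateSpec.cost_add_le`). Finally L =
O(log(Cn)/ε), by `Params.L_add_one_le`. -/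

noncomputable section

namespace DynamicSetCover

/-! ### A program logic for total correctness with step counts -/

section

variable {m : ℕ} {α β : Type}

/-- The program stops when it is started in `σ`, and its result, its final store and its number of
steps satisfy `Q`. -/
def WP (x : Prog m α) (σ : Store m) (Q : α → Store m → ℕ → Prop) : Prop :=
  ∃ T : ℕ, (x σ).2.2 = (T : ℕ∞) ∧ Q (x σ).1 (x σ).2.1 T

namespace WP

variable {x : Prog m α} {g : α → Prog m β} {σ : Store m}

theorem mono {Q Q' : α → Store m → ℕ → Prop} (h : WP x σ Q)
    (hQ : ∀ a τ T, Q a τ T → Q' a τ T) : WP x σ Q' := by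
  obtain ⟨T, hT, h⟩ := h
  exact ⟨T, hT, hQ _ _ _ h⟩

theorem bind {Q : β → Store m → ℕ → Prop}
    (h : WP x σ fun a τ T => WP (g a) τ fun b υ T' => Q b υ (T + T')) :
    WP (x >>= g) σ Q := by
  obtain ⟨T, hT, T', hT', h⟩ := h
  refine ⟨T + T', ?_, h⟩
  change (x σ).2.2 + (g (x σ).1 (x σ).2.1).2.2 = _
  rw [hT, hT']
  push_cast
  rfl

theorem seq {P : α → Store m → ℕ → Prop} {Q : β → Store m → ℕ → Prop} (h : WP x σ P)
    (h' : ∀ a τ T, P a τ T → WP (g a) τ fun b υ T' => Q b υ (T + T')) :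
    WP (x >>= g) σ Q :=
  bind (h.mono h')

theorem pure {Q : α → Store m → ℕ → Prop} {a : α} (h : Q a σ 0) :
    WP (Pure.pure a : Prog m α) σ Q :=
  ⟨0, rfl, h⟩

theorem query {Q : α → Store m → ℕ → Prop} {g : Store m → α} (h : Q (g σ) σ 1) :
    WP (query g) σ Q :=
  ⟨1, rfl, h⟩

theorem act {Q : Unit → Store m → ℕ → Prop} {g : Store m → Store m} (h : Q () (g σ) 1) :
    WP (act g) σ Q :=
  ⟨1, rfl, h⟩

theorem tick {Q : Unit → Store m → ℕ → Prop} (h : Q () σ 1) : WP tick σ Q :=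
  ⟨1, rfl, h⟩

theorem ite {c : Prop} [Decidable c] {y z : Prog m α} {Q : α → Store m → ℕ → Prop}
    (hy : c → WP y σ Q) (hz : ¬ c → WP z σ Q) : WP (if c then y else z) σ Q := by
  split_ifs with h
  exacts [hy h, hz h]

theorem query_bind {γ : Type} {Q : β → Store m → ℕ → Prop} {q : Store m → γ} {g : γ → Prog m β}
    (h : WP (g (q σ)) σ fun b υ T => Q b υ (1 + T)) :
    WP (DynamicSetCover.query q >>= g) σ Q :=
  bind (query h)

theorem act_bind {Q : β → Store m → ℕ → Prop} {q : Store m → Store m} {g : Unit → Prog m β}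
    (h : WP (g ()) (q σ) fun b υ T => Q b υ (1 + T)) :
    WP (DynamicSetCover.act q >>= g) σ Q :=
  bind (act h)

theorem tick_bind {Q : β → Store m → ℕ → Prop} {g : Unit → Prog m β}
    (h : WP (g ()) σ fun b υ T => Q b υ (1 + T)) :
    WP (DynamicSetCover.tick >>= g) σ Q :=
  bind (tick h)

/-- The rule for loops: `I l b τ T` holds before each test of the loop condition, where `l` is the
list of the items that are still to be processed and `T` the number of steps done so far. -/
theorem foldLoop {g : β → α → Prog m β} (I : List α → β → Store m → ℕ → Prop)
    (step : ∀ a l b τ T, I (a :: l) b τ T → WP (g b a) τ fun b' υ T' => I l b' υ (T + (1 + T')))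
    {l : List α} {b : β} (h : I l b σ 0) :
    WP (foldLoop g l b) σ fun b' τ T => ∃ T', T = T' + 1 ∧ I [] b' τ T' := by
  -- The invariant sees the steps since the start of the loop, so the induction carries the number
  -- T₀ of steps already done.
  suffices H : ∀ (l : List α) (b : β) (σ : Store m) (T₀ : ℕ), I l b σ T₀ →
      WP (DynamicSetCover.foldLoop g l b) σ fun b' τ T => ∃ T', T₀ + T = T' + 1 ∧ I [] b' τ T' by
    simpa using H l b σ 0 h
  intro l
  induction l with
  | nil =>
    intro b σ T₀ h
    exact tick_bind (pure ⟨T₀, rfl, h⟩)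
  | cons a l ih =>
    intro b σ T₀ h
    refine tick_bind ((step a l b σ T₀ h).seq fun b' υ T' h' => (ih b' υ _ h').mono ?_)
    rintro b'' τ T ⟨T'', h, h'⟩
    exact ⟨T'', by omega, h'⟩

/-- Loops with a bound on the cost of an iteration. -/
theorem foldLoop_le {g : β → α → Prog m β} (I : List α → β → Store m → Prop) (c : ℕ)
    {l : List α} {b : β} (h : I l b σ)
    (step : ∀ a l' b τ, a ∈ l → I (a :: l') b τ → WP (g b a) τ fun b' υ T => I l' b' υ ∧ T ≤ c) :
    WP (DynamicSetCover.foldLoop g l b) σ fun b' τ T =>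
      I [] b' τ ∧ T ≤ (c + 1) * l.length + 1 := by
  -- Each remaining item reserves its cost c plus one loop test; the extra 1 in the conclusion is
  -- the test that ends the loop.
  refine (foldLoop (fun l' b' τ T => (∀ a ∈ l', a ∈ l) ∧ I l' b' τ ∧
    T + (c + 1) * l'.length ≤ (c + 1) * l.length) ?_ ⟨fun _ h => h, h, by simp⟩).mono ?_
  · rintro a l' b' τ T ⟨h1, h2, h3⟩
    refine (step a l' b' τ (h1 a (by simp)) h2).mono fun b'' υ T' ⟨h4, h5⟩ =>
      ⟨fun x hx => h1 x (by simp [hx]), h4, ?_⟩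
    simp only [List.length_cons, mul_add] at h3
    linarith
  · rintro b' τ T ⟨T', rfl, -, h, h'⟩
    exact ⟨h, by simp at h'; omega⟩

theorem each_le {g : α → Prog m Unit} (I : List α → Store m → Prop) (c : ℕ)
    {l : List α} (h : I l σ)
    (step : ∀ a l' τ, a ∈ l → I (a :: l') τ → WP (g a) τ fun _ υ T => I l' υ ∧ T ≤ c) :
    WP (each l g) σ fun _ τ T => I [] τ ∧ T ≤ (c + 1) * l.length + 1 :=
  foldLoop_le (fun l' _ τ => I l' τ) c h fun a l' _ τ => step a l' τ

theorem each_const {g : α → Prog m Unit} (I : Store m → Prop) (c : ℕ)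
    {l : List α} (h : I σ)
    (step : ∀ a τ, a ∈ l → I τ → WP (g a) τ fun _ υ T => I υ ∧ T ≤ c) :
    WP (each l g) σ fun _ τ T => I τ ∧ T ≤ (c + 1) * l.length + 1 :=
  each_le (fun _ τ => I τ) c h fun a _ τ => step a τ

/-- Loops through the numbers below `n`. -/
theorem foldLoop_range {g : β → ℕ → Prog m β} (I : ℕ → β → Store m → ℕ → Prop) (n : ℕ)
    {b : β} (h : I 0 b σ 0)
    (step : ∀ i b τ T, i < n → I i b τ T →
      WP (g b i) τ fun b' υ T' => I (i + 1) b' υ (T + (1 + T'))) :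
    WP (DynamicSetCover.foldLoop g (List.range n) b) σ fun b' τ T =>
      ∃ T', T = T' + 1 ∧ I n b' τ T' := by
  refine (foldLoop (fun l b τ T => ∃ i, i ≤ n ∧ l = List.range' i (n - i) ∧ I i b τ T) ?_
    ⟨0, by omega, by simp [List.range_eq_range'], h⟩).mono ?_
  · rintro a l b τ T ⟨i, hi, hl, h⟩
    obtain ⟨d, hd⟩ : ∃ d, n - i = d + 1 := by
      cases hd : n - i with
      | zero => simp [hd] at hl
      | succ d => exact ⟨d, rfl⟩
    rw [hd, List.range'_succ] at hl
    obtain ⟨rfl, rfl⟩ := List.cons.inj hl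
    refine (step a b τ T (by omega) h).mono fun b' υ T' h' => ⟨a + 1, by omega, ?_, h'⟩
    rw [show n - (a + 1) = d by omega]
  · rintro b τ T ⟨T', rfl, i, hi, hl, h⟩
    have : n - i = 0 := by simpa using congrArg List.length hl.symm
    obtain rfl : i = n := by omega
    exact ⟨T', rfl, h⟩

/-- Loops through the numbers below `n` in decreasing order. -/
theorem each_range_reverse {g : ℕ → Prog m Unit} (I : ℕ → Store m → ℕ → Prop) (n : ℕ)
    (h : I n σ 0)
    (step : ∀ i τ T, i < n → I (i + 1) τ T → WP (g i) τ fun _ υ T' => I i υ (T + (1 + T'))) :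
    WP (each (List.range n).reverse g) σ fun _ τ T => ∃ T', T = T' + 1 ∧ I 0 τ T' := by
  refine (foldLoop (fun l _ τ T => ∃ i, i ≤ n ∧ l = (List.range i).reverse ∧ I i τ T) ?_
    ⟨n, le_rfl, rfl, h⟩).mono ?_
  · rintro a l b τ T ⟨i, hi, hl, h⟩
    cases i with
    | zero => simp at hl
    | succ i =>
      simp only [List.range_succ, List.reverse_append, List.reverse_cons, List.reverse_nil,
        List.nil_append, List.singleton_append, List.cons.injEq] at hl
      obtain ⟨rfl, rfl⟩ := hl
      exact (step a τ T (by omega) h).mono fun b' υ T' h' => ⟨a, by omega, rfl, h'⟩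
  · rintro b τ T ⟨T', rfl, i, hi, hl, h⟩
    have : i = 0 := by simpa using congrArg List.length hl.symm
    subst this
    exact ⟨T', rfl, h⟩

/-- The rule for `while` loops: `μ` bounds the number of iterations and `Φ` pays for them. -/
theorem whileLoop {cond : Store m → Bool} {body : Prog m Unit} (I : Store m → Prop)
    (μ Φ : Store m → ℕ)
    (step : ∀ τ, I τ → cond τ = true →
      WP body τ fun _ υ T => I υ ∧ μ υ < μ τ ∧ T + 1 + Φ υ ≤ Φ τ)
    (N : ℕ) (h : I σ) (hN : μ σ < N) :
    WP (whileLoop cond body N) σ fun _ τ T => I τ ∧ cond τ = false ∧ T + Φ τ ≤ Φ σ + 1 := by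
  induction N generalizing σ with
  | zero => omega
  | succ N ih =>
    refine query_bind (ite (fun hc => ?_) fun hc => pure ⟨h, by simpa using hc, by omega⟩)
    refine (step σ h hc).seq fun _ υ T h' => (ih h'.1 (by omega)).mono ?_
    rintro _ τ T' ⟨h1, h2, h3⟩
    exact ⟨h1, h2, by omega⟩

end WP

end

/-! ### The lists of elements -/

namespace Store

variable {m : ℕ}

/-- The lists `A_i`, `P_i`, `D_i` have no repetitions, and they agree with the states and levels of
the elements. -/
structure ListsOk (σ : Store m) : Prop where
  nodup : ∀ st i, (σ.list st i).Nodup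
  loc : ∀ {st i e}, e ∈ σ.list st i → σ.status e = st ∧ σ.elevel e = i
  lt : ∀ {st i e}, e ∈ σ.list st i → e < σ.next

/-- The elements at levels `≤ k`, dead ones included. -/
def kept (σ : Store m) (k : ℕ) : Finset ℕ :=
  (Finset.range (k + 1)).biUnion fun i =>
    (σ.list .active i).toFinset ∪ (σ.list .passive i).toFinset ∪ (σ.list .dead i).toFinset

theorem mem_kept {σ : Store m} {k e : ℕ} :
    e ∈ σ.kept k ↔ ∃ i ≤ k, ∃ st, e ∈ σ.list st i := by
  simp only [kept, Finset.mem_biUnion, Finset.mem_range, Finset.mem_union, List.mem_toFinset,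
    Nat.lt_succ_iff]
  constructor
  · rintro ⟨i, hi, (h | h) | h⟩
    exacts [⟨i, hi, _, h⟩, ⟨i, hi, _, h⟩, ⟨i, hi, _, h⟩]
  · rintro ⟨i, hi, st, h⟩
    refine ⟨i, hi, ?_⟩
    cases st <;> simp [h]

theorem kept_mono (σ : Store m) {j k : ℕ} (h : j ≤ k) : σ.kept j ⊆ σ.kept k := by
  intro e he
  obtain ⟨i, hi, st, he⟩ := mem_kept.1 he
  exact mem_kept.2 ⟨i, hi.trans h, st, he⟩

/-- The number of elements in a given state at levels `≤ k`. -/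
def count (σ : Store m) (st : Status) (k : ℕ) : ℕ :=
  ∑ i ∈ Finset.range (k + 1), (σ.list st i).length

/-- All these lists are pairwise disjoint, because an element has only one state and one level. -/
theorem ListsOk.count_add {σ : Store m} (h : σ.ListsOk) (k : ℕ) :
    σ.count .active k + σ.count .passive k + σ.count .dead k = (σ.kept k).card := by
  rw [kept, Finset.card_biUnion, count, count, count, ← Finset.sum_add_distrib,
    ← Finset.sum_add_distrib]
  · refine Finset.sum_congr rfl fun i _ => ?_
    rw [Finset.card_union_of_disjoint, Finset.card_union_of_disjoint,
      List.toFinset_card_of_nodup (h.nodup _ _), List.toFinset_card_of_nodup (h.nodup _ _),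
      List.toFinset_card_of_nodup (h.nodup _ _)]
    · rw [Finset.disjoint_left]
      intro e he he'
      have := (h.loc (List.mem_toFinset.1 he)).1.symm.trans (h.loc (List.mem_toFinset.1 he')).1
      cases this
    · rw [Finset.disjoint_left]
      intro e he he'
      have h' := (h.loc (List.mem_toFinset.1 he')).1
      rcases Finset.mem_union.1 he with he | he <;>
      · have := (h.loc (List.mem_toFinset.1 he)).1.symm.trans h'
        cases this
  · intro i _ j _ hij
    rw [Function.onFun, Finset.disjoint_left]
    intro e he he'
    apply hij
    have key : ∀ l, e ∈ (σ.list .active l).toFinset ∪ (σ.list .passive l).toFinset ∪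
        (σ.list .dead l).toFinset → σ.elevel e = l := by
      intro l hl
      simp only [Finset.mem_union, List.mem_toFinset] at hl
      rcases hl with (hl | hl) | hl
      exacts [(h.loc hl).2, (h.loc hl).2, (h.loc hl).2]
    exact (key i he).symm.trans (key j he')

theorem list_setList (σ : Store m) (st st' : Status) (i i' : ℕ) (l : List ℕ) :
    (σ.setList st i l).list st' i' = if st' = st ∧ i' = i then l else σ.list st' i' := by
  by_cases hst : st' = st
  · subst hst
    by_cases hi : i' = i <;> simp [setList, hi]
  · simp [setList, hst]

/-- Erasing `e` from the one list named by its state and level removes it from every list, since no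
other list can contain it. -/
theorem ListsOk.mem_unlink {σ : Store m} (h : σ.ListsOk) (e x : ℕ) (st : Status) (i : ℕ) :
    x ∈ (σ.unlink e).list st i ↔ x ∈ σ.list st i ∧ x ≠ e := by
  rw [unlink, list_setList]
  split_ifs with hc
  · rw [(h.nodup _ _).mem_erase_iff, hc.1, hc.2, and_comm]
  · refine ⟨fun hx => ⟨hx, ?_⟩, fun hx => hx.1⟩
    rintro rfl
    exact hc ⟨(h.loc hx).1.symm, (h.loc hx).2.symm⟩

theorem ListsOk.unlink {σ : Store m} (h : σ.ListsOk) (e : ℕ) : (σ.unlink e).ListsOk where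
  nodup st i := by
    rw [Store.unlink, list_setList]
    split_ifs
    exacts [(h.nodup _ _).erase _, h.nodup _ _]
  loc hx := h.loc ((h.mem_unlink _ _ _ _).1 hx).1
  lt hx := h.lt ((h.mem_unlink _ _ _ _).1 hx).1

theorem mem_link {σ : Store m} (e x : ℕ) (st st' : Status) (i i' : ℕ) :
    x ∈ (σ.link e st i).list st' i' ↔ (x = e ∧ st' = st ∧ i' = i) ∨ x ∈ σ.list st' i' := by
  change x ∈ (σ.setList st i (e :: σ.list st i)).list st' i' ↔ _
  rw [list_setList]
  split_ifs with hc
  · simp [hc.1, hc.2]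
  · simp [hc]

theorem ListsOk.link {σ : Store m} (h : σ.ListsOk) {e : ℕ} (he : ∀ st i, e ∉ σ.list st i)
    (hlt : e < σ.next) (st : Status) (i : ℕ) : (σ.link e st i).ListsOk where
  nodup st' i' := by
    change ((σ.setList st i (e :: σ.list st i)).list st' i').Nodup
    rw [list_setList]
    split_ifs
    · exact List.nodup_cons.2 ⟨he _ _, h.nodup _ _⟩
    · exact h.nodup _ _
  loc {st' i' x} hx := by
    change Function.update σ.status e st x = st' ∧ Function.update σ.elevel e i x = i'
    rcases (mem_link _ _ _ _ _ _).1 hx with ⟨rfl, rfl, rfl⟩ | hx'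
    · simp
    · have : x ≠ e := by
        rintro rfl
        exact he _ _ hx'
      simpa [this] using h.loc hx'
  lt hx := by
    rcases (mem_link _ _ _ _ _ _).1 hx with ⟨rfl, rfl, rfl⟩ | hx
    exacts [hlt, h.lt hx]

theorem ListsOk.mem_move {σ : Store m} (h : σ.ListsOk) (e x : ℕ) (st st' : Status) (i i' : ℕ) :
    x ∈ (σ.move e st i).list st' i' ↔
      (x = e ∧ st' = st ∧ i' = i) ∨ (x ∈ σ.list st' i' ∧ x ≠ e) := by
  rw [move, mem_link, h.mem_unlink]

theorem ListsOk.move {σ : Store m} (h : σ.ListsOk) {e : ℕ} (hlt : e < σ.next)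
    (st : Status) (i : ℕ) : (σ.move e st i).ListsOk :=
  (h.unlink e).link (fun _ _ he => ((h.mem_unlink _ _ _ _).1 he).2 rfl) hlt st i

end Store

/-! ### The invariant of a rebuild -/

/-- What holds throughout a rebuild of the levels `≤ k` that starts in the store `σ₀`. The dead
elements at these levels are in `X`, the sets that have been found are given by `φ`, and the sets
that are alive in the level-fixing phase by `α`. -/
structure Rebuilding {m : ℕ} (k : ℕ) (σ₀ : Store m) (X : Set ℕ) (φ α : Fin m → Bool)
    (σ : Store m) : Prop where
  next : σ.next = σ₀.next
  sets : σ.sets = σ₀.sets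
  counter : σ.counter = σ₀.counter
  lists : σ.ListsOk
  -- Nothing is claimed for j ≤ k: elements may be redistributed there at will, as the counters of
  -- these levels are reset at the end.
  kept : ∀ j > k, σ.kept j ⊆ σ₀.kept j
  dead : ∀ i ≤ k, ∀ e ∈ σ.list .dead i, e ∈ X
  found : σ.found = φ
  alive : σ.setAlive = α

/-- The part of the store that matters for the running time of the phases of a rebuild. -/
def Store.core {m : ℕ} (σ : Store m) :=
  (σ.next, σ.sets, σ.counter, σ.status, σ.elevel, σ.list)

namespace Rebuilding

variable {m k : ℕ} {σ₀ σ τ : Store m} {X : Set ℕ} {φ α : Fin m → Bool}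

/-- Weights, set levels, the cover and the remaining scratch fields lie outside the invariant, so
accesses that change only these preserve it by `rfl`. -/
theorem congr (h : Rebuilding k σ₀ X φ α σ) (e : τ.core = σ.core) :
    Rebuilding k σ₀ X τ.found τ.setAlive τ := by
  obtain ⟨h1, h2, h3, h4, h5, h6, h7, h8⟩ := h
  simp only [Store.core, Prod.mk.injEq] at e
  obtain ⟨e1, e2, e3, e4, e5, e6⟩ := e
  refine ⟨e1.trans h1, e2.trans h2, e3.trans h3, ⟨?_, ?_, ?_⟩, ?_, ?_, rfl, rfl⟩
  · rw [e6]; exact h4.nodup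
  · rw [e6, e4, e5]; exact h4.loc
  · rw [e6, e1]; exact h4.lt
  · intro j hj
    simpa only [Store.kept, e6] using h5 j hj
  · rw [e6]; exact h6

theorem congr' (h : Rebuilding k σ₀ X φ α σ) (e : τ.core = σ.core) (e₁ : τ.found = σ.found)
    (e₂ : τ.setAlive = σ.setAlive) : Rebuilding k σ₀ X φ α τ := by
  have := h.congr e
  rwa [e₁, e₂, h.found, h.alive] at this

theorem unlink (h : Rebuilding k σ₀ X φ α σ) (e : ℕ) :
    Rebuilding k σ₀ (X \ {e}) φ α (σ.unlink e) where
  next := h.next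
  sets := h.sets
  counter := h.counter
  lists := h.lists.unlink e
  kept j hj x hx := by
    obtain ⟨i, hi, st, hx⟩ := Store.mem_kept.1 hx
    exact h.kept j hj (Store.mem_kept.2 ⟨i, hi, st, ((h.lists.mem_unlink _ _ _ _).1 hx).1⟩)
  dead i hi x hx := by
    have := (h.lists.mem_unlink _ _ _ _).1 hx
    exact ⟨h.dead i hi x this.1, this.2⟩
  found := h.found
  alive := h.alive

/-- The new level `i` is arbitrary: an element that started at a level ≤ k is already counted in
`σ₀.kept j` for every j > k. -/
theorem move (h : Rebuilding k σ₀ X φ α σ) (h₀ : σ₀.ListsOk) {e : ℕ} (he : e ∈ σ₀.kept k)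
    {st : Status} (hst : st ≠ .dead) (i : ℕ) :
    Rebuilding k σ₀ X φ α (σ.move e st i) where
  next := h.next
  sets := h.sets
  counter := h.counter
  lists := by
    refine h.lists.move ?_ st i
    obtain ⟨_, _, _, he⟩ := Store.mem_kept.1 he
    rw [h.next]
    exact h₀.lt he
  kept j hj x hx := by
    obtain ⟨i', hi', st', hx⟩ := Store.mem_kept.1 hx
    rcases (h.lists.mem_move _ _ _ _ _ _).1 hx with ⟨rfl, -, -⟩ | hx
    · exact σ₀.kept_mono hj.le he
    · exact h.kept j hj (Store.mem_kept.2 ⟨i', hi', st', hx.1⟩)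
  dead i' hi' x hx := by
    rcases (h.lists.mem_move _ _ _ _ _ _).1 hx with ⟨-, h', -⟩ | hx
    · exact absurd h'.symm hst
    · exact h.dead i' hi' x hx.1
  found := h.found
  alive := h.alive

end Rebuilding

/-! ### Loops that only read the store -/

section

variable {m : ℕ} (p : Params m) {σ : Store m}

theorem wp_foldLoop_query {α β : Type} (q : β → α → Store m → β) (l : List α) (b : β) :
    WP (foldLoop (fun b a => query (q b a)) l b) σ
      fun _ τ T => τ = σ ∧ T ≤ 2 * l.length + 1 :=
  WP.foldLoop_le (fun _ _ τ => τ = σ) 1 rfl fun _ _ _ _ _ h => WP.query ⟨h, le_rfl⟩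

/-- The maximum is described by its upper bounds, which is the form of the conditions in `load` and
`InsertsAtMost`. -/
theorem wp_maxLevel (F : List (Fin m)) : WP (maxLevel F) σ
    fun i τ T => τ = σ ∧ T ≤ 2 * F.length + 1 ∧ ∀ j, i ≤ j ↔ ∀ s ∈ F, σ.slevel s ≤ j := by
  refine (WP.foldLoop_le (fun l b τ => τ = σ ∧
    ∀ j, (∀ s ∈ F, σ.slevel s ≤ j) ↔ b ≤ j ∧ ∀ s ∈ l, σ.slevel s ≤ j) 1 ⟨rfl, by simp⟩ ?_).mono ?_
  · rintro s l b τ - ⟨rfl, h⟩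
    refine WP.query ⟨⟨rfl, fun j => ?_⟩, le_rfl⟩
    rw [h]
    simp [and_assoc]
  · rintro i τ T ⟨⟨rfl, h⟩, h'⟩
    exact ⟨rfl, h', fun j => by simp [h]⟩

theorem wp_leastSlack (F : List (Fin m)) : WP (leastSlack p F) σ
    fun _ τ T => τ = σ ∧ T ≤ 2 * F.length + 1 := by
  cases F with
  | nil => exact WP.pure ⟨rfl, by omega⟩
  | cons s F =>
    refine WP.query_bind ((wp_foldLoop_query _ F _).mono ?_)
    rintro _ τ T ⟨rfl, h⟩
    exact ⟨rfl, by simp only [List.length_cons]; omega⟩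

theorem wp_collect (st : Status) (k : ℕ) : WP (collect st k) σ
    fun l τ T => τ = σ ∧ (∀ e, e ∈ l ↔ ∃ i ≤ k, e ∈ σ.list st i) ∧ l.length = σ.count st k ∧
      T ≤ 2 * σ.count st k + 3 * (k + 1) + 1 := by
  have inner : ∀ (τ : Store m) (l acc : List ℕ), WP (foldLoop (fun acc e => do
      tick
      pure (e :: acc)) l acc) τ fun l' υ T => υ = τ ∧ (∀ e, e ∈ l' ↔ e ∈ acc ∨ e ∈ l) ∧
        l'.length = acc.length + l.length ∧ T ≤ 2 * l.length + 1 := by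
    intro τ l acc
    refine (WP.foldLoop_le (fun l' acc' υ => υ = τ ∧
      (∀ e, (e ∈ acc' ∨ e ∈ l') ↔ (e ∈ acc ∨ e ∈ l)) ∧
      acc'.length + l'.length = acc.length + l.length) 1 ⟨rfl, by simp, rfl⟩ ?_).mono ?_
    · rintro a l' acc' υ - ⟨rfl, h1, h2⟩
      refine WP.tick_bind (WP.pure ⟨⟨rfl, fun e => ?_, ?_⟩, le_rfl⟩)
      · rw [← h1]
        simp only [List.mem_cons]
        tauto
      · simp only [List.length_cons] at h2 ⊢
        omega
    · rintro l' υ T ⟨⟨rfl, h1, h2⟩, h3⟩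
      exact ⟨rfl, fun e => by simp [← h1], by simpa using h2, h3⟩
  -- A level costs 3 steps (the outer test, reading the list, the last inner test) and each of its
  -- elements 2.
  refine (WP.foldLoop_range (fun n acc τ T => τ = σ ∧
    (∀ e, e ∈ acc ↔ ∃ i < n, e ∈ σ.list st i) ∧
    acc.length = ∑ i ∈ Finset.range n, (σ.list st i).length ∧
    T ≤ 2 * acc.length + 3 * n) (k + 1) ⟨rfl, by simp, by simp, by simp⟩ ?_).mono ?_
  · rintro n acc τ T - ⟨rfl, h1, h2, h3⟩
    refine WP.query_bind ((inner τ _ _).mono ?_)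
    rintro l υ T' ⟨rfl, h4, h5, h6⟩
    refine ⟨rfl, fun e => ?_, ?_, ?_⟩
    · rw [h4, h1]
      constructor
      · rintro (⟨i, hi, h⟩ | h)
        exacts [⟨i, by omega, h⟩, ⟨n, by omega, h⟩]
      · rintro ⟨i, hi, h⟩
        rcases Nat.lt_succ_iff_lt_or_eq.1 hi with hi | rfl
        exacts [Or.inl ⟨i, hi, h⟩, Or.inr h]
    · rw [h5, h2, Finset.sum_range_succ]
    · rw [h5]
      omega
  · rintro l τ T ⟨T', rfl, rfl, h1, h2, h3⟩
    refine ⟨rfl, fun e => ?_, h2, ?_⟩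
    · simpa [Nat.lt_succ_iff] using h1 e
    · rw [Store.count, ← h2]
      omega

end

/-! ### The phases of a rebuild that precede the fixing of the levels -/

namespace Rebuilding

variable {m k f : ℕ} {σ₀ σ : Store m} {X : Set ℕ} {φ α : Fin m → Bool} (p : Params m)

theorem reweigh (hf : ∀ e, (σ₀.sets e).length ≤ f) (h : Rebuilding k σ₀ X φ α σ) (e : ℕ)
    (x : ℝ) : WP (reweigh p e x) σ
      fun _ τ T => Rebuilding k σ₀ X φ α τ ∧ T ≤ 2 * f + 4 := by
  refine WP.query_bind (WP.act_bind (WP.query_bind ?_))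
  have h' : Rebuilding k σ₀ X φ α (σ.setw e x) := h.congr' rfl rfl rfl
  refine WP.mono (WP.each_const (Rebuilding k σ₀ X φ α) 1 h' ?_) ?_
  · exact fun s τ _ hτ => WP.act ⟨hτ.congr' rfl rfl rfl, le_rfl⟩
  rintro _ τ T ⟨h1, h2⟩
  refine ⟨h1, ?_⟩
  change T ≤ (1 + 1) * (σ.sets e).length + 1 at h2
  rw [h.sets] at h2
  have := hf e
  omega

theorem settlePassive (hf : ∀ e, (σ₀.sets e).length ≤ f) (h₀ : σ₀.ListsOk)
    (h : Rebuilding k σ₀ X φ α σ) {e : ℕ} (he : e ∈ σ₀.kept k) :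
    WP (settlePassive p k e) σ
      fun _ τ T => Rebuilding k σ₀ X φ α τ ∧ T ≤ 6 * f + 8 := by
  have hl : (σ.sets e).length ≤ f := h.sets ▸ hf e
  refine WP.query_bind ((wp_foldLoop_query _ _ _).seq ?_)
  rintro b _ T ⟨rfl, hT⟩
  refine WP.ite (fun _ => ?_) fun _ => ?_
  · refine (h.reweigh p hf e _).seq ?_
    rintro _ τ T' ⟨h', hT'⟩
    exact WP.act ⟨h'.move h₀ he (by decide) _, by omega⟩
  · refine (wp_leastSlack p _).seq ?_
    rintro x _ T' ⟨rfl, hT'⟩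
    refine (h.reweigh p hf e _).mono ?_
    rintro _ τ T'' ⟨h', hT''⟩
    exact ⟨h', by omega⟩

/-- The flags mirror the accumulated list, so no set is listed twice; absence of repetitions is
needed later to put each set into one bucket. An element contributes at most `f` sets. -/
theorem findSets (hf : ∀ e, (σ₀.sets e).length ≤ f) (h : Rebuilding k σ₀ X φ α σ)
    (es : List ℕ) {S : List (Fin m)} (hS : S.Nodup) (hφ : ∀ s, φ s = true ↔ s ∈ S) :
    WP (findSets k es S) σ fun S' τ T => (∃ φ', Rebuilding k σ₀ X φ' α τ ∧
        ∀ s, φ' s = true ↔ s ∈ S') ∧ S'.Nodup ∧ S'.length ≤ S.length + f * es.length ∧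
        T ≤ (3 * f + 3) * es.length + 1 := by
  refine (WP.foldLoop_le (fun es' S' τ => (∃ φ', Rebuilding k σ₀ X φ' α τ ∧
    ∀ s, φ' s = true ↔ s ∈ S') ∧ S'.Nodup ∧
    S'.length + f * es'.length ≤ S.length + f * es.length) (3 * f + 2)
    ⟨⟨φ, h, hφ⟩, hS, le_rfl⟩ ?_).mono ?_
  · rintro e es' S₁ τ - ⟨⟨φ₁, h1, h2⟩, h3, h4⟩
    refine WP.query_bind ((WP.foldLoop_le (fun F S' τ => (∃ φ', Rebuilding k σ₀ X φ' α τ ∧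
      ∀ s, φ' s = true ↔ s ∈ S') ∧ S'.Nodup ∧
      S'.length + F.length ≤ S₁.length + (τ.sets e).length) 2 ⟨⟨φ₁, h1, h2⟩, h3, le_rfl⟩ ?_).mono
      ?_)
    · rintro s F S' τ - ⟨⟨φ₂, h5, h6⟩, h7, h8⟩
      simp only [List.length_cons] at h8
      refine WP.query_bind (WP.ite (fun hb => ?_) fun _ => ?_)
      · have hs : s ∉ S' := by
          rw [← h6, ← h5.found]
          simp only [Bool.and_eq_true, Bool.not_eq_true', decide_eq_true_eq] at hb
          simp [hb.2]
        have h9 := h5.congr (τ := τ.setFound s true) rfl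
        rw [show (τ.setFound s true).setAlive = α from h5.alive] at h9
        refine WP.act_bind (WP.pure ⟨⟨⟨_, h9, ?_⟩, List.nodup_cons.2 ⟨hs, h7⟩, ?_⟩, le_rfl⟩)
        · intro s'
          change Function.update τ.found s true s' = true ↔ _
          by_cases hs' : s' = s
          · simp [hs']
          · simp [hs', h5.found, h6]
        · simp only [List.length_cons]
          change _ ≤ _ + (τ.sets e).length
          omega
      · exact WP.pure ⟨⟨⟨φ₂, h5, h6⟩, h7, by omega⟩, by omega⟩
    · rintro S' υ T ⟨⟨⟨φ₂, h5, h6⟩, h7, h8⟩, h9⟩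
      have hl := hf e
      rw [h1.sets] at h9
      rw [h5.sets] at h8
      simp only [List.length_cons, mul_add, List.length_nil] at h4 h8
      exact ⟨⟨⟨φ₂, h5, h6⟩, h7, by omega⟩, by omega⟩
  · rintro S' τ T ⟨⟨h1, h2, h3⟩, h4⟩
    exact ⟨h1, h2, by simpa using h3, h4⟩

theorem lowerSets (h : Rebuilding k σ₀ X φ α σ) {S : List (Fin m)} (hS : S.Nodup) :
    WP (lowerSets p k S) σ fun S' τ T => Rebuilding k σ₀ X φ α τ ∧ S'.Nodup ∧
      S'.length ≤ S.length ∧ T ≤ 3 * S.length + 1 := by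
  refine (WP.foldLoop_le (fun l S' τ => Rebuilding k σ₀ X φ α τ ∧ (l ++ S').Nodup ∧
    l.length + S'.length ≤ S.length) 2 ⟨h, by simpa using hS, by simp⟩ ?_).mono ?_
  · rintro s l S' τ - ⟨h1, h2, h3⟩
    simp only [List.length_cons] at h3
    refine WP.query_bind (WP.ite (fun _ => ?_) fun _ => ?_)
    · exact WP.pure ⟨⟨h1, (List.nodup_cons.1 h2).2, by omega⟩, by omega⟩
    · refine WP.act_bind (WP.pure ⟨⟨h1.congr' rfl rfl rfl, ?_, ?_⟩, le_rfl⟩)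
      · exact (List.perm_middle.nodup_iff).2 h2
      · simp only [List.length_cons]
        omega
  · rintro S' τ T ⟨⟨h1, h2, h3⟩, h4⟩
    exact ⟨h1, h2, by simpa using h3, h4⟩

theorem lowerElements (hf : ∀ e, (σ₀.sets e).length ≤ f) (h₀ : σ₀.ListsOk)
    (h : Rebuilding k σ₀ X φ α σ) {es E : List ℕ} (hes : ∀ e ∈ es, e ∈ σ₀.kept k)
    (hE : ∀ e ∈ E, e ∈ σ₀.kept k) :
    WP (lowerElements p k es E) σ fun E' τ T => Rebuilding k σ₀ X φ α τ ∧
      (∀ e ∈ E', e ∈ σ₀.kept k) ∧ E'.length ≤ es.length + E.length ∧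
      T ≤ (4 * f + 8) * es.length + 1 := by
  refine (WP.foldLoop_le (fun l E' τ => Rebuilding k σ₀ X φ α τ ∧ (∀ e ∈ E', e ∈ σ₀.kept k) ∧
    l.length + E'.length ≤ es.length + E.length) (4 * f + 7) ⟨h, hE, le_rfl⟩ ?_).mono ?_
  · rintro e l E' τ he ⟨h1, h2, h3⟩
    have hl : (τ.sets e).length ≤ f := h1.sets ▸ hf e
    simp only [List.length_cons] at h3
    refine WP.query_bind ((wp_maxLevel _).seq ?_)
    rintro i _ T ⟨rfl, hT, -⟩
    refine WP.ite (fun _ => ?_) fun _ => WP.pure ⟨⟨h1, h2, by omega⟩, by omega⟩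
    refine WP.act_bind (((h1.move h₀ (hes e he) (by decide) k).reweigh p hf e _).seq ?_)
    rintro _ υ T' ⟨h4, hT'⟩
    refine WP.pure ⟨⟨h4, ?_, ?_⟩, by omega⟩
    · simpa using ⟨hes e he, h2⟩
    · simp only [List.length_cons]
      omega
  · rintro E' τ T ⟨⟨h1, h2, h3⟩, h4⟩
    exact ⟨h1, h2, by simpa using h3, h4⟩

end Rebuilding

/-- Used for potentials when one access changes a single summand; the summands `a` (released) and
`b` (added) avoid subtraction in ℕ. -/
theorem sum_add_le_sum_add {ι : Type*} {I : Finset ι} {x y : ι → ℕ} {s : ι} {a b : ℕ}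
    (hs : s ∈ I) (h : ∀ t ∈ I, t ≠ s → y t ≤ x t) (h' : y s + a ≤ x s + b) :
    ∑ t ∈ I, y t + a ≤ ∑ t ∈ I, x t + b := by
  classical
  rw [← Finset.add_sum_erase I x hs, ← Finset.add_sum_erase I y hs]
  have := Finset.sum_le_sum fun t (ht : t ∈ I.erase s) =>
    h t (Finset.mem_of_mem_erase ht) (Finset.ne_of_mem_erase ht)
  omega

/-! ### The buckets -/

namespace Store

variable {m : ℕ}

/-- The buckets `Γ[0], …, Γ[k]` have no repetitions, and they contain only alive sets with the right
target level. -/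
structure BucketsOk (k : ℕ) (σ : Store m) : Prop where
  nodup : ∀ j ≤ k, (σ.bucket j).Nodup
  mem : ∀ j ≤ k, ∀ s ∈ σ.bucket j, σ.setAlive s = true ∧ σ.target s = j

variable {k : ℕ} {σ : Store m}

theorem BucketsOk.mem_unbucket (h : σ.BucketsOk k) (s x : Fin m) {j : ℕ} (hj : j ≤ k) :
    x ∈ (σ.unbucket s).bucket j ↔ x ∈ σ.bucket j ∧ x ≠ s := by
  change x ∈ Function.update σ.bucket _ _ j ↔ _
  by_cases hjt : j = σ.target s
  · subst hjt
    rw [Function.update_self, (h.nodup _ hj).mem_erase_iff, and_comm]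
  · rw [Function.update_of_ne hjt]
    refine ⟨fun hx => ⟨hx, ?_⟩, And.left⟩
    rintro rfl
    exact hjt (h.mem j hj x hx).2.symm

theorem BucketsOk.unbucket (h : σ.BucketsOk k) (s : Fin m) : (σ.unbucket s).BucketsOk k where
  nodup j hj := by
    change (Function.update σ.bucket _ _ j).Nodup
    by_cases hjt : j = σ.target s
    · subst hjt
      rw [Function.update_self]
      exact (h.nodup _ hj).erase _
    · rw [Function.update_of_ne hjt]
      exact h.nodup j hj
  mem j hj x hx := h.mem j hj x ((h.mem_unbucket s x hj).1 hx).1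

theorem mem_enbucket (s x : Fin m) (i j : ℕ) :
    x ∈ (σ.enbucket s i).bucket j ↔ (x = s ∧ j = i) ∨ x ∈ σ.bucket j := by
  change x ∈ Function.update σ.bucket _ _ j ↔ _
  by_cases hj : j = i <;> simp [hj]

theorem BucketsOk.enbucket (h : σ.BucketsOk k) {s : Fin m} (hs : ∀ j ≤ k, s ∉ σ.bucket j)
    (ha : σ.setAlive s = true) (i : ℕ) : (σ.enbucket s i).BucketsOk k where
  nodup j hj := by
    change (Function.update σ.bucket _ _ j).Nodup
    by_cases hji : j = i
    · subst hji
      rw [Function.update_self]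
      exact List.nodup_cons.2 ⟨hs j hj, h.nodup j hj⟩
    · rw [Function.update_of_ne hji]
      exact h.nodup j hj
  mem j hj x hx := by
    change σ.setAlive x = true ∧ Function.update σ.target s i x = j
    rcases (mem_enbucket _ _ _ _).1 hx with ⟨rfl, rfl⟩ | hx'
    · simp [ha]
    · have : x ≠ s := by
        rintro rfl
        exact hs j hj hx'
      simpa [this] using h.mem j hj x hx'

/-- Retargeting during round i never sends a set above level i, so a finished round stays finished.
-/
theorem targetLevel_le (p : Params m) (k i : ℕ) (s : Fin m) (σ : Store m) :
    σ.targetLevel p k i s ≤ i := by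
  unfold targetLevel
  split_ifs
  exacts [Nat.zero_le _, Nat.findGreatest_le _]

/-- What is still to be paid for the alive sets in the level-fixing phase. -/
def setPotential (σ : Store m) : ℕ :=
  -- Freezing a set takes 4 accesses, the last test of the loop through its members and one `while`
  -- test; every member takes a loop test and a look at its flag.
  ∑ s, if σ.setAlive s then 2 * (σ.members s).length + 6 else 0

/-- What is still to be paid for the alive sets, and the alive elements of `E` at the price `c`. -/
def potential (E : Finset ℕ) (c : ℕ) (σ : Store m) : ℕ :=
  σ.setPotential + ∑ e ∈ E, if σ.eltAlive e then c else 0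

end Store

/-! ### The level-fixing phase -/

/-- What holds in the level-fixing phase of a rebuild of the levels `≤ k` when all the alive sets
have target levels below `n`; the elements of the alive sets are in `E`. -/
structure Fixing {m : ℕ} (k : ℕ) (σ₀ : Store m) (X : Set ℕ) (φ : Fin m → Bool) (E : Finset ℕ)
    (n : ℕ) (σ : Store m) : Prop where
  base : Rebuilding k σ₀ X φ σ.setAlive σ
  buckets : σ.BucketsOk k
  target : ∀ s, σ.setAlive s = true → σ.target s < n ∧ s ∈ σ.bucket (σ.target s)
  members : ∀ s, σ.setAlive s = true → ∀ e ∈ σ.members s, e ∈ E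

namespace Fixing

variable {m k f : ℕ} {σ₀ σ : Store m} {X : Set ℕ} {φ : Fin m → Bool} {E : Finset ℕ} {i : ℕ}
  (p : Params m)

theorem retarget (h : Fixing k σ₀ X φ E (i + 1) σ) (hi : i ≤ k) {s : Fin m}
    (hs : σ.setAlive s = true) (c : ℕ) :
    WP (retarget p k i s) σ fun _ τ T => Fixing k σ₀ X φ E (i + 1) τ ∧
      τ.setAlive = σ.setAlive ∧ τ.potential E c = σ.potential E c ∧ T ≤ 3 := by
  refine WP.query_bind (WP.act_bind (WP.act ⟨?_, rfl, rfl, le_rfl⟩))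
  have hj := Store.targetLevel_le p k i s σ
  generalize σ.targetLevel p k i s = j at *
  refine ⟨h.base.congr' rfl rfl rfl, (h.buckets.unbucket s).enbucket
    (fun j hj => by simp [h.buckets.mem_unbucket s s hj]) hs j, fun s' hs' => ?_, h.members⟩
  change Function.update σ.target s j s' < i + 1 ∧
    s' ∈ ((σ.unbucket s).enbucket s j).bucket (Function.update σ.target s j s')
  by_cases hss : s' = s
  · subst hss
    rw [Function.update_self, Store.mem_enbucket]
    exact ⟨by omega, Or.inl ⟨rfl, rfl⟩⟩
  · rw [Function.update_of_ne hss, Store.mem_enbucket]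
    obtain ⟨h1, h2⟩ := h.target s' hs'
    exact ⟨h1, Or.inr ((h.buckets.mem_unbucket _ _ (by omega)).2 ⟨h2, hss⟩)⟩

/-- The price 7f + 5 consists of 4 accesses, the last loop test and 7 steps for each set containing
the element: loop test, weight, flag, decrement and the 3 steps of `retarget`. -/
theorem freezeElement (hf : ∀ e, (σ₀.sets e).length ≤ f) (h₀ : σ₀.ListsOk)
    (hE : ∀ e ∈ E, e ∈ σ₀.kept k)
    (h : Fixing k σ₀ X φ E (i + 1) σ) (hi : i ≤ k) {e : ℕ} (he : e ∈ E)
    (ha : σ.eltAlive e = true) :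
    WP (freezeElement p k i e) σ fun _ τ T => Fixing k σ₀ X φ E (i + 1) τ ∧
      τ.setAlive = σ.setAlive ∧ T + τ.potential E (7 * f + 5) ≤ σ.potential E (7 * f + 5) := by
  refine WP.act_bind (WP.act_bind (WP.act_bind (WP.query_bind ?_)))
  set σ₁ : Store m := (((σ.move e .active i).setw e (p.lw i)).setEltAlive e false) with hσ₁
  have h1 : Fixing k σ₀ X φ E (i + 1) σ₁ :=
    ⟨(h.base.move h₀ (hE e he) (by decide) i).congr' rfl rfl rfl, ⟨h.buckets.1, h.buckets.2⟩,
      h.target, h.members⟩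
  have hpot : σ₁.potential E (7 * f + 5) + (7 * f + 5) ≤ σ.potential E (7 * f + 5) := by
    have := sum_add_le_sum_add (I := E) (x := fun e => if σ.eltAlive e then 7 * f + 5 else 0)
      (y := fun e => if σ₁.eltAlive e then 7 * f + 5 else 0) (s := e) (a := 7 * f + 5) (b := 0) he
      (fun t _ ht => by
        change (if Function.update σ.eltAlive e false t = true then _ else _) ≤ _
        rw [Function.update_of_ne ht])
      (by
        change (if Function.update σ.eltAlive e false e = true then _ else _) + _ ≤ _
        simp [ha])
    have h3 : σ₁.setPotential = σ.setPotential := rfl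
    rw [Store.potential, Store.potential, h3]
    omega
  refine WP.mono (WP.each_const (fun τ => Fixing k σ₀ X φ E (i + 1) τ ∧
    τ.setAlive = σ.setAlive ∧ τ.potential E (7 * f + 5) = σ₁.potential E (7 * f + 5)) 6
    ⟨h1, rfl, rfl⟩ ?_) ?_
  · rintro s τ - ⟨h2, h3, h4⟩
    have h2' : Fixing k σ₀ X φ E (i + 1) (τ.addW p s (p.lw i - p.lw k)) :=
      ⟨h2.base.congr' rfl rfl rfl, ⟨h2.buckets.1, h2.buckets.2⟩, h2.target, h2.members⟩
    refine WP.act_bind (WP.query_bind (WP.ite (fun hb => ?_) fun _ => ?_))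
    · have h2'' : Fixing k σ₀ X φ E (i + 1) ((τ.addW p s (p.lw i - p.lw k)).decAlive s) :=
        ⟨h2'.base.congr' rfl rfl rfl, ⟨h2'.buckets.1, h2'.buckets.2⟩, h2'.target, h2'.members⟩
      refine WP.act_bind ((h2''.retarget p hi hb (7 * f + 5)).mono ?_)
      rintro _ υ T ⟨h5, h6, h7, h8⟩
      exact ⟨⟨h5, h6.trans h3, h7.trans h4⟩, by omega⟩
    · exact WP.pure ⟨⟨h2', h3, h4⟩, by omega⟩
  · rintro _ τ T ⟨⟨h2, h3, h4⟩, h5⟩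
    refine ⟨h2, h3, ?_⟩
    rw [h1.base.sets] at h5
    have := hf e
    rw [h4]
    omega

/-- The number of alive sets drops, which makes the `while` loop stop. The credit of the frozen set
pays for scanning its members, some of which may be frozen already; those still alive pay for their
own freezing. -/
theorem freezeNext (hf : ∀ e, (σ₀.sets e).length ≤ f) (h₀ : σ₀.ListsOk)
    (hE : ∀ e ∈ E, e ∈ σ₀.kept k)
    (h : Fixing k σ₀ X φ E (i + 1) σ) (hi : i ≤ k) (hb : (!(σ.bucket i).isEmpty) = true) :
    WP (freezeNext p k i) σ fun _ τ T => Fixing k σ₀ X φ E (i + 1) τ ∧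
      (Finset.univ.filter fun s => τ.setAlive s = true).card <
        (Finset.univ.filter fun s => σ.setAlive s = true).card ∧
      T + 1 + τ.potential E (7 * f + 5) ≤ σ.potential E (7 * f + 5) := by
  refine WP.query_bind ?_
  cases hl : σ.bucket i with
  | nil => simp [hl] at hb
  | cons s l =>
    obtain ⟨hs, hsi⟩ := h.buckets.mem i hi s (by simp [hl])
    refine WP.act_bind (WP.act_bind (WP.query_bind ?_))
    set σ₁ : Store m := (σ.freezeSet s).setLevel s i with hσ₁
    have hal : ∀ t, σ₁.setAlive t = true ↔ σ.setAlive t = true ∧ t ≠ s := by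
      intro t
      change Function.update σ.setAlive s false t = true ↔ _
      by_cases hts : t = s <;> simp [hts]
    have h1 : Fixing k σ₀ X φ E (i + 1) σ₁ := by
      refine ⟨?_,
        ⟨fun j hj => (h.buckets.unbucket s).nodup j hj, fun j hj t ht => ?_⟩,
        fun t ht => ?_, fun t ht => h.members t ((hal t).1 ht).1⟩
      · have := h.base.congr (τ := σ₁) rfl
        rwa [show σ₁.found = φ from h.base.found] at this
      · have := (h.buckets.mem_unbucket s t hj).1 ht
        have h2 := h.buckets.mem j hj t this.1
        exact ⟨(hal t).2 ⟨h2.1, this.2⟩, h2.2⟩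
      · rw [hal] at ht
        obtain ⟨h2, h3⟩ := h.target t ht.1
        exact ⟨h2, (h.buckets.mem_unbucket s t (j := σ.target t) (by omega)).2 ⟨h3, ht.2⟩⟩
    have hpot : σ₁.potential E (7 * f + 5) + (2 * (σ.members s).length + 6) ≤
        σ.potential E (7 * f + 5) := by
      have := sum_add_le_sum_add (I := Finset.univ)
        (x := fun t => if σ.setAlive t then 2 * (σ.members t).length + 6 else 0)
        (y := fun t => if σ₁.setAlive t then 2 * (σ₁.members t).length + 6 else 0) (s := s)
        (a := 2 * (σ.members s).length + 6) (b := 0) (Finset.mem_univ s)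
        (fun t _ ht => by
          change (if Function.update σ.setAlive s false t = true then _ else _) ≤ _
          rw [Function.update_of_ne ht]
          exact le_rfl)
        (by
          change (if Function.update σ.setAlive s false s = true then _ else _) + _ ≤ _
          simp [hs])
      have h3 : ∀ e, σ₁.eltAlive e = σ.eltAlive e := fun _ => rfl
      simp only [Store.potential, Store.setPotential, h3]
      omega
    refine WP.mono (WP.foldLoop (fun l _ τ T => Fixing k σ₀ X φ E (i + 1) τ ∧
      τ.setAlive = σ₁.setAlive ∧ (∀ e ∈ l, e ∈ E) ∧
      T + 2 * l.length + τ.potential E (7 * f + 5) ≤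
        2 * (σ.members s).length + σ₁.potential E (7 * f + 5)) ?_
      ⟨h1, rfl, h.members s hs, by
        change 0 + 2 * (σ.members s).length + _ ≤ _
        omega⟩) ?_
    · rintro e l _ τ T ⟨h2, h3, h4, h5⟩
      simp only [List.length_cons] at h5
      refine WP.query_bind (WP.ite (fun ha => ?_) fun _ => ?_)
      · refine (h2.freezeElement p hf h₀ hE hi (h4 e (by simp)) ha).mono ?_
        rintro _ υ T' ⟨h6, h7, h8⟩
        exact ⟨h6, h7.trans h3, fun x hx => h4 x (by simp [hx]), by omega⟩
      · exact WP.pure ⟨h2, h3, fun x hx => h4 x (by simp [hx]), by omega⟩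
    · rintro _ τ T ⟨T', rfl, h2, h3, -, h5⟩
      refine ⟨h2, ?_, by simp only [List.length_nil] at h5; omega⟩
      rw [h3]
      refine Finset.card_lt_card ⟨fun t ht => ?_, fun hss => ?_⟩
      · simp only [Finset.mem_filter, Finset.mem_univ, true_and] at ht ⊢
        exact ((hal t).1 ht).1
      · have := hss (Finset.mem_filter.2 ⟨Finset.mem_univ s, hs⟩)
        exact ((hal s).1 (Finset.mem_filter.1 this).2).2 rfl

/-- All the rounds together. -/
theorem rounds (hf : ∀ e, (σ₀.sets e).length ≤ f) (h₀ : σ₀.ListsOk)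
    (hE : ∀ e ∈ E, e ∈ σ₀.kept k) (h : Fixing k σ₀ X φ E (k + 1) σ) :
    WP (each (List.range (k + 1)).reverse (fun i =>
      whileLoop (fun σ => !(σ.bucket i).isEmpty) (DynamicSetCover.freezeNext p k i) (m + 1))) σ
      fun _ τ T => Rebuilding k σ₀ X φ (fun _ => false) τ ∧
        T ≤ σ.potential E (7 * f + 5) + 2 * (k + 1) + 1 := by
  refine (WP.each_range_reverse (fun n τ T => Fixing k σ₀ X φ E n τ ∧
    T + τ.potential E (7 * f + 5) + 2 * n ≤ σ.potential E (7 * f + 5) + 2 * (k + 1)) (k + 1)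
    ⟨h, by omega⟩ ?_).mono ?_
  · rintro i τ T hi ⟨h1, h2⟩
    refine (WP.whileLoop (Fixing k σ₀ X φ E (i + 1))
      (fun τ => (Finset.univ.filter fun s => τ.setAlive s = true).card)
      (Store.potential E (7 * f + 5))
      (fun τ hτ hc => hτ.freezeNext p hf h₀ hE (by omega) hc) (m + 1) h1 ?_).mono ?_
    · exact Nat.lt_succ_of_le ((Finset.card_le_univ _).trans (by simp))
    · rintro _ υ T' ⟨h3, h4, h5⟩
      -- Bucket i is empty when the round ends, so no alive set has target i, and the strict bound
      -- on targets drops from i + 1 to i.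
      refine ⟨⟨h3.base, h3.buckets, fun s hs => ?_, h3.members⟩, by omega⟩
      obtain ⟨h6, h7⟩ := h3.target s hs
      refine ⟨lt_of_le_of_ne (Nat.lt_succ_iff.1 h6) fun h8 => ?_, h7⟩
      have h9 : υ.bucket i = [] := by simpa using h4
      rw [h8, h9] at h7
      simp at h7
  · rintro _ τ T ⟨T', rfl, h1, h2⟩
    -- After round 0 an alive set would have a target below 0.
    have : τ.setAlive = fun _ => false := by
      funext s
      by_contra hs
      exact absurd (h1.target s (by simpa using hs)).1 (by omega)
    exact ⟨this ▸ h1.base, by omega⟩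

end Fixing

/-- Opening a set creates 6 units of potential and recording an incidence at most 2. The rounds thus
start with at most 6|S| + 2f|E| + (7f+5)|E| units, and the preparatory loops are linear in k + 1,
|S| and f|E| + |E|. -/
theorem Rebuilding.fixLevels {m k f : ℕ} {σ₀ σ : Store m} {X : Set ℕ} {φ : Fin m → Bool}
    (p : Params m) (hf : ∀ e, (σ₀.sets e).length ≤ f) (h₀ : σ₀.ListsOk)
    (h : Rebuilding k σ₀ X φ (fun _ => false) σ) {S : List (Fin m)} (hS : S.Nodup) {E : List ℕ}
    (hE : ∀ e ∈ E, e ∈ σ₀.kept k) :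
    WP (fixLevels p k S E) σ fun _ τ T => Rebuilding k σ₀ X φ (fun _ => false) τ ∧
      T ≤ 4 * (k + 1) + 11 * S.length + (11 * f + 9) * E.length + 5 := by
  -- emptying the buckets
  refine (WP.each_le (fun l τ => Rebuilding k σ₀ X φ (fun _ => false) τ ∧
    ∀ j ≤ k, j ∉ l → τ.bucket j = []) 1 ⟨h, fun j hj hj' => ?_⟩ ?_).seq ?_
  · simp at hj'
    omega
  · rintro i l τ - ⟨h1, h2⟩
    refine WP.act ⟨⟨h1.congr' rfl rfl rfl, fun j hj hjl => ?_⟩, le_rfl⟩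
    change Function.update τ.bucket i [] j = []
    by_cases hji : j = i
    · simp [hji]
    · rw [Function.update_of_ne hji]
      exact h2 j hj (by simp [hji, hjl])
  rintro _ σ₁ T₁ ⟨⟨h1, hb1⟩, hT₁⟩
  simp only [List.length_range] at hT₁
  -- opening the sets
  refine (WP.each_le (fun l τ => Rebuilding k σ₀ X φ τ.setAlive τ ∧ (∀ j ≤ k, τ.bucket j = []) ∧
    (∀ s, τ.setAlive s = true → s ∈ S ∧ τ.members s = []) ∧
    (∀ s ∈ S, s ∉ l → τ.setAlive s = true) ∧
    τ.setPotential + 6 * l.length ≤ 6 * S.length) 1 ⟨?_, ?_, ?_, ?_, ?_⟩ ?_).seq ?_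
  · rwa [h1.alive]
  · exact fun j hj => hb1 j hj (by simp)
  · simp [h1.alive]
  · exact fun s hs hs' => absurd hs hs'
  · simp [Store.setPotential, h1.alive]
  · rintro s l τ hs ⟨h2, h3, h4, h5, h6⟩
    have h2' := h2.congr (τ := τ.openSet s) rfl
    rw [show (τ.openSet s).found = φ from h2.found] at h2'
    refine WP.act ⟨⟨h2', h3, fun t ht => ?_, fun t ht htl => ?_, ?_⟩, le_rfl⟩
    · change t ∈ S ∧ Function.update τ.members s [] t = []
      by_cases hts : t = s
      · simp [hts, hs]
      · change Function.update τ.setAlive s true t = true at ht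
        rw [Function.update_of_ne hts] at ht ⊢
        exact h4 t ht
    · change Function.update τ.setAlive s true t = true
      by_cases hts : t = s
      · simp [hts]
      · rw [Function.update_of_ne hts]
        exact h5 t ht (by simp [hts, htl])
    · have := sum_add_le_sum_add (I := Finset.univ)
        (x := fun t => if τ.setAlive t then 2 * (τ.members t).length + 6 else 0)
        (y := fun t => if (τ.openSet s).setAlive t then
          2 * ((τ.openSet s).members t).length + 6 else 0) (s := s)
        (a := 0) (b := 6) (Finset.mem_univ s)
        (fun t _ ht => by simp [Store.openSet, ht])
        (by simp [Store.openSet])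
      simp only [Store.setPotential, List.length_cons] at h6 ⊢
      omega
  rintro _ σ₂ T₂ ⟨⟨h2, hb2, ha2, ha2', hp2⟩, hT₂⟩
  -- recording the elements
  refine (WP.each_le (fun l τ => Rebuilding k σ₀ X φ τ.setAlive τ ∧ (∀ j ≤ k, τ.bucket j = []) ∧
    τ.setAlive = σ₂.setAlive ∧
    (∀ s, τ.setAlive s = true → ∀ e ∈ τ.members s, e ∈ E.toFinset) ∧
    τ.setPotential + 2 * f * l.length ≤ 6 * S.length + 2 * f * E.length) (2 * f + 3)
    ⟨h2, hb2, rfl, fun s hs => by simp [(ha2 s hs).2],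
      by simp only [List.length_nil] at hp2; omega⟩ ?_).seq ?_
  · rintro e l τ he ⟨h3, h4, h5, h6, h7⟩
    simp only [List.length_cons, mul_add] at h7
    have hl : (τ.sets e).length ≤ f := h3.sets ▸ hf e
    have h3' : Rebuilding k σ₀ X φ τ.setAlive (τ.setEltAlive e true) := h3.congr' rfl rfl rfl
    refine WP.act_bind (WP.query_bind (WP.mono (WP.each_le (fun F υ =>
      Rebuilding k σ₀ X φ υ.setAlive υ ∧ (∀ j ≤ k, υ.bucket j = []) ∧
      υ.setAlive = σ₂.setAlive ∧
      (∀ s, υ.setAlive s = true → ∀ e ∈ υ.members s, e ∈ E.toFinset) ∧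
      υ.setPotential + 2 * F.length ≤ τ.setPotential + 2 * (τ.sets e).length) 1
      ⟨h3', h4, h5, h6, le_rfl⟩ ?_) ?_))
    · rintro s F υ - ⟨h8, h9, h10, h11, h12⟩
      refine WP.act ⟨⟨h8.congr' rfl rfl rfl, h9, h10, fun t ht x hx => ?_, ?_⟩, le_rfl⟩
      · change x ∈ Function.update υ.members s (e :: υ.members s) t at hx
        by_cases hts : t = s
        · subst hts
          rw [Function.update_self, List.mem_cons] at hx
          rcases hx with rfl | hx
          · simpa using he
          · exact h11 t ht x hx
        · rw [Function.update_of_ne hts] at hx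
          exact h11 t ht x hx
      · have := sum_add_le_sum_add (I := Finset.univ)
          (x := fun t => if υ.setAlive t then 2 * (υ.members t).length + 6 else 0)
          (y := fun t => if (υ.addMember s e).setAlive t then
            2 * ((υ.addMember s e).members t).length + 6 else 0) (s := s)
          (a := 0) (b := 2) (Finset.mem_univ s)
          (fun t _ ht => by simp [Store.addMember, ht])
          (by
            simp only [Store.addMember, Function.update_self, List.length_cons]
            -- A set that is not alive may receive members too; its summand stays 0.
            split_ifs <;> omega)
        simp only [Store.setPotential, List.length_cons] at h12 ⊢
        omega
    · rintro _ υ T ⟨⟨h8, h9, h10, h11, h12⟩, h13⟩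
      change T ≤ (1 + 1) * (τ.sets e).length + 1 at h13
      simp only [List.length_nil] at h12
      exact ⟨⟨h8, h9, h10, h11, by omega⟩, by omega⟩
  rintro _ σ₃ T₃ ⟨⟨h3, hb3, ha3, hm3, hp3⟩, hT₃⟩
  -- filling the buckets
  refine (WP.each_le (fun l τ => Rebuilding k σ₀ X φ τ.setAlive τ ∧ τ.BucketsOk k ∧
    τ.setAlive = σ₃.setAlive ∧ τ.members = σ₃.members ∧ l.Nodup ∧
    (∀ s ∈ l, ∀ j ≤ k, s ∉ τ.bucket j) ∧
    (∀ s ∈ S, s ∉ l → τ.target s < k + 1 ∧ s ∈ τ.bucket (τ.target s))) 2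
    ⟨h3, ⟨fun j hj => by simp [hb3 j hj], fun j hj => by simp [hb3 j hj]⟩, rfl, rfl, hS,
      fun s _ j hj => by simp [hb3 j hj], fun s hs hs' => absurd hs hs'⟩ ?_).seq ?_
  · rintro s l τ hs ⟨h4, h5, h6, h7, h8, h9, h10⟩
    refine WP.query_bind (WP.act ⟨?_, le_rfl⟩)
    have hj := Store.targetLevel_le p k k s τ
    generalize τ.targetLevel p k k s = j at *
    have hsl := List.nodup_cons.1 h8
    refine ⟨h4.congr' rfl rfl rfl, h5.enbucket (h9 s (by simp)) ?_ j, h6, h7, hsl.2,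
      fun t ht j' hj' => ?_, fun t ht htl => ?_⟩
    · rw [h6, ha3]
      exact ha2' s hs (by simp)
    · rw [Store.mem_enbucket]
      rintro (⟨rfl, -⟩ | h')
      exacts [hsl.1 ht, h9 t (by simp [ht]) j' hj' h']
    · rw [Store.mem_enbucket]
      change Function.update τ.target s j t < k + 1 ∧
        ((t = s ∧ Function.update τ.target s j t = j) ∨
          t ∈ τ.bucket (Function.update τ.target s j t))
      by_cases hts : t = s
      · subst hts
        simp
        omega
      · rw [Function.update_of_ne hts]
        have := h10 t ht (by simp [hts, htl])
        exact ⟨this.1, Or.inr this.2⟩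
  rintro _ σ₄ T₄ ⟨⟨h4, hb4, ha4, hm4, -, -, ht4⟩, hT₄⟩
  have hfix : Fixing k σ₀ X φ E.toFinset (k + 1) σ₄ := by
    refine ⟨h4, hb4, fun s hs => ht4 s ?_ (by simp), fun s hs => ?_⟩
    · rw [ha4, ha3] at hs
      exact (ha2 s hs).1
    · rw [ha4] at hs
      rw [hm4]
      exact hm3 s hs
  refine (hfix.rounds p hf h₀ (by simpa using hE)).mono ?_
  rintro _ τ T₅ ⟨h5, hT₅⟩
  refine ⟨h5, ?_⟩
  have hpot : σ₄.potential E.toFinset (7 * f + 5) ≤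
      6 * S.length + 2 * f * E.length + (7 * f + 5) * E.length := by
    have e1 : σ₄.setPotential = σ₃.setPotential := by
      simp only [Store.setPotential, ha4, hm4]
    have e2 : ∑ e ∈ E.toFinset, (if σ₄.eltAlive e then 7 * f + 5 else 0) ≤
        (7 * f + 5) * E.length := by
      calc _ ≤ ∑ _e ∈ E.toFinset, (7 * f + 5) := Finset.sum_le_sum fun _ _ => by split_ifs <;> omega
        _ = (7 * f + 5) * E.toFinset.card := by rw [Finset.sum_const, smul_eq_mul, mul_comm]
        _ ≤ _ := Nat.mul_le_mul_left _ (List.toFinset_card_le E)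
    rw [Store.potential, e1]
    simp only [List.length_nil] at hp3
    omega
  have e3 : (11 * f + 9) * E.length =
    2 * f * E.length + (7 * f + 5) * E.length + (2 * f + 4) * E.length := by ring
  have e4 : (2 * f + 3 + 1) * E.length = (2 * f + 4) * E.length := rfl
  omega

section

/-! ### The cost and the effect of a rebuild -/

variable {m : ℕ}

/-- The invariant of the store between two updates. -/
structure Store.Wf (f : ℕ) (σ : Store m) : Prop where
  sets_le : ∀ e, (σ.sets e).length ≤ f
  fresh : ∀ e, σ.next ≤ e → σ.sets e = []
  lists : σ.ListsOk
  found : σ.found = fun _ => false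
  alive : σ.setAlive = fun _ => false

theorem wp_resetCounters (p : Params m) (k : ℕ) (σ : Store m) :
    WP (resetCounters p k) σ fun _ τ T => T ≤ 4 * (k + 1) + 1 ∧
      ∃ c : ℕ → ℝ, τ = { σ with counter := c } ∧ (∀ j > k, c j = σ.counter j) ∧
        ∀ j ≤ k, c j = p.ε * ((σ.count .active j + σ.count .passive j : ℕ) : ℝ) := by
  refine WP.seq (WP.foldLoop_range (fun n N τ T => T ≤ 4 * n ∧
    N = ∑ i ∈ Finset.range n, (σ.list .active i).length +
      ∑ i ∈ Finset.range n, (σ.list .passive i).length ∧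
    ∃ c : ℕ → ℝ, τ = { σ with counter := c } ∧ (∀ j ≥ n, c j = σ.counter j) ∧
      ∀ j < n, c j = p.ε * ((σ.count .active j + σ.count .passive j : ℕ) : ℝ)) (k + 1)
    ⟨by omega, by simp, σ.counter, rfl, fun _ _ => rfl, by simp⟩ ?_) ?_
  · rintro n N τ T hn ⟨h1, h2, c, rfl, h3, h4⟩
    have hN : N + (σ.list .active n).length + (σ.list .passive n).length =
        σ.count .active n + σ.count .passive n := by
      rw [h2, Store.count, Store.count, Finset.sum_range_succ, Finset.sum_range_succ]
      ring
    refine WP.query_bind (WP.act_bind (WP.pure ⟨by omega, hN,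
      Function.update c n (p.ε * ((σ.count .active n + σ.count .passive n : ℕ) : ℝ)), ?_,
      fun j hj => ?_, fun j hj => ?_⟩))
    · rw [← hN]
      rfl
    · rw [Function.update_of_ne (by omega)]
      exact h3 j (by omega)
    · by_cases hjn : j = n
      · subst hjn
        rw [Function.update_self]
      · rw [Function.update_of_ne hjn]
        exact h4 j (by omega)
  · rintro N τ T ⟨T', rfl, h1, -, c, rfl, h3, h4⟩
    exact WP.pure ⟨by omega, c, rfl, fun j hj => h3 j hj, fun j hj => h4 j (by omega)⟩

theorem Rebuilding.mono {k : ℕ} {σ₀ σ : Store m} {X Y : Set ℕ} {φ α : Fin m → Bool}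
    (h : Rebuilding k σ₀ X φ α σ) (hXY : X ⊆ Y) : Rebuilding k σ₀ Y φ α σ :=
  { h with dead := fun i hi e he => hXY (h.dead i hi e he) }

/-- Every phase does O(f) work per listed element and O(1) per listed set, of which there are at
most f times as many as kept elements. Loops over levels and constants go into the term with k + 1.
-/
theorem wp_rebuild (p : Params m) {f : ℕ} (hf : 1 ≤ f) (k : ℕ) {σ : Store m} (h : σ.Wf f) :
    WP (rebuild p k) σ fun _ τ T => τ.Wf f ∧ τ.next = σ.next ∧
      (∀ j > k, τ.counter j = σ.counter j ∧ τ.kept j ⊆ σ.kept j) ∧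
      (∀ j ≤ k, τ.counter j = p.ε * ((τ.kept j).card : ℝ)) ∧
      T ≤ 100 * (f * (σ.kept k).card) + 50 * (k + 1) := by
  have hs := h.sets_le
  have h₀ := h.lists
  refine (wp_collect .active k).seq ?_
  rintro as _ T₁ ⟨rfl, has, hA, hT₁⟩
  refine (wp_collect .passive k).seq ?_
  rintro ps _ T₂ ⟨rfl, hps, hP, hT₂⟩
  refine (wp_collect .dead k).seq ?_
  rintro ds σ₀ T₃ ⟨rfl, hds, hD, hT₃⟩
  have hN := h₀.count_add k
  rw [← hA, ← hP, ← hD] at hN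
  rw [← hA] at hT₁
  rw [← hP] at hT₂
  rw [← hD] at hT₃
  have hask : ∀ e ∈ as, e ∈ σ₀.kept k := fun e he => by
    obtain ⟨i, hi, he⟩ := (has e).1 he
    exact Store.mem_kept.2 ⟨i, hi, _, he⟩
  have hpsk : ∀ e ∈ ps, e ∈ σ₀.kept k := fun e he => by
    obtain ⟨i, hi, he⟩ := (hps e).1 he
    exact Store.mem_kept.2 ⟨i, hi, _, he⟩
  have hR : Rebuilding k σ₀ {x | x ∈ ds} (fun _ => false) (fun _ => false) σ₀ :=
    ⟨rfl, rfl, rfl, h₀, fun _ _ => subset_rfl, fun i hi e he => (hds e).2 ⟨i, hi, he⟩,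
      h.found, h.alive⟩
  refine (hR.findSets hs as List.nodup_nil (by simp)).seq ?_
  rintro S₁ σ₁ T₄ ⟨⟨φ₁, h1, hφ₁⟩, hS₁, hl₁, hT₄⟩
  refine (h1.findSets hs ps hS₁ hφ₁).seq ?_
  rintro S₂ σ₂ T₅ ⟨⟨φ₂, h2, hφ₂⟩, hS₂, hl₂, hT₅⟩
  refine (h2.findSets hs ds hS₂ hφ₂).seq ?_
  rintro S σ₃ T₆ ⟨⟨φ, h3, hφ⟩, hS, hl, hT₆⟩
  simp only [List.length_nil, zero_add] at hl₁
  -- The dead elements at levels ≤ k are among those still to be processed; afterwards none is left,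
  -- and no later phase creates one.
  refine (WP.each_le (fun l τ => Rebuilding k σ₀ {x | x ∈ l} φ (fun _ => false) τ) (2 * f + 5)
    h3 ?_).seq ?_
  · intro e l τ _ hτ
    refine (hτ.reweigh p hs e 0).seq ?_
    rintro _ υ T ⟨hυ, hT⟩
    refine WP.act ⟨(hυ.unlink e).mono ?_, by omega⟩
    rintro x ⟨hx, hxe⟩
    exact (List.mem_cons.1 hx).resolve_left hxe
  rintro _ σ₄ T₇ ⟨h4, hT₇⟩
  refine (WP.each_const _ _ h4 fun e τ _ hτ => hτ.reweigh p hs e 0).seq ?_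
  rintro _ σ₅ T₈ ⟨h5, hT₈⟩
  refine (WP.each_const _ 1 h5 ?_).seq ?_
  · exact fun s τ _ hτ => WP.act ⟨hτ.congr' rfl rfl rfl, le_rfl⟩
  rintro _ σ₆ T₉ ⟨h6, hT₉⟩
  refine (WP.each_const _ 1 h6 ?_).seq ?_
  · exact fun e τ he hτ => WP.act ⟨hτ.move h₀ (hpsk e he) (by decide) _, le_rfl⟩
  rintro _ σ₇ T₁₀ ⟨h7, hT₁₀⟩
  refine (WP.each_const _ (2 * f + 5) h7 ?_).seq ?_
  · intro e τ he hτ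
    refine WP.act_bind (((hτ.move h₀ (hask e he) (by decide) (k + 1)).reweigh p hs e _).mono ?_)
    rintro _ υ T ⟨hυ, hT⟩
    exact ⟨hυ, by omega⟩
  rintro _ σ₈ T₁₁ ⟨h8, hT₁₁⟩
  refine (WP.each_const _ _ h8 fun e τ he hτ => hτ.settlePassive p hs h₀ (hpsk e he)).seq ?_
  rintro _ σ₉ T₁₂ ⟨h9, hT₁₂⟩
  refine (h9.lowerSets p hS).seq ?_
  rintro S' σ₁₀ T₁₃ ⟨h10, hS', hl', hT₁₃⟩
  refine (h10.lowerElements p hs h₀ hask (E := []) (by simp)).seq ?_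
  rintro E₁ σ₁₁ T₁₄ ⟨h11, hE₁, hlE₁, hT₁₄⟩
  refine (h11.lowerElements p hs h₀ hpsk hE₁).seq ?_
  rintro E σ₁₂ T₁₅ ⟨h12, hE, hlE, hT₁₅⟩
  refine (h12.fixLevels p hs h₀ hS' hE).seq ?_
  rintro _ σ₁₃ T₁₆ ⟨h13, hT₁₆⟩
  refine (wp_resetCounters p k σ₁₃).seq ?_
  rintro _ _ T₁₇ ⟨hT₁₇, c, rfl, hc, hc'⟩
  refine (WP.each_le (fun l τ => ∃ g, τ = { σ₁₃ with counter := c, found := g } ∧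
    ∀ s, g s = true → s ∈ l) 1 ⟨σ₁₃.found, rfl, fun s hs => ?_⟩ ?_).mono ?_
  · rw [h13.found] at hs
    exact (hφ s).1 hs
  · rintro s l _ - ⟨g, rfl, hg⟩
    refine WP.act ⟨⟨Function.update g s false, rfl, fun t ht => ?_⟩, le_rfl⟩
    by_cases hts : t = s
    · simp [hts] at ht
    · rw [Function.update_of_ne hts] at ht
      exact (List.mem_cons.1 (hg t ht)).resolve_left hts
  rintro _ _ T₁₈ ⟨⟨g, rfl, hg⟩, hT₁₈⟩
  refine ⟨⟨fun e => h13.sets ▸ hs e, fun e he => ?_, ⟨h13.lists.1, h13.lists.2, h13.lists.3⟩, ?_,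
    h13.alive⟩, h13.next, fun j hj => ⟨?_, h13.kept j hj⟩, fun j hj => ?_, ?_⟩
  · change σ₁₃.sets e = []
    rw [h13.sets]
    exact h.fresh e (h13.next ▸ he)
  · funext s
    simpa using hg s
  · change c j = _
    rw [hc j hj, h13.counter]
  · change c j = p.ε * ((σ₁₃.kept j).card : ℝ)
    -- Without dead elements, the active and passive ones counted by `resetCounters` are all the
    -- kept ones.
    have hd : σ₁₃.count .dead j = 0 := by
      refine Finset.sum_eq_zero fun i hi => List.length_eq_zero_iff.2
        (List.eq_nil_iff_forall_not_mem.2 fun e he => ?_)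
      have := Finset.mem_range.1 hi
      simpa using h13.dead i (by omega) e he
    rw [hc' j hj, ← h13.lists.count_add, hd, add_zero]
  · have hA' : as.length ≤ f * as.length := Nat.le_mul_of_pos_left _ hf
    have hP' : ps.length ≤ f * ps.length := Nat.le_mul_of_pos_left _ hf
    have hD' : ds.length ≤ f * ds.length := Nat.le_mul_of_pos_left _ hf
    simp only [List.length_nil, add_zero] at *
    have hfE : f * E.length ≤ f * (as.length + ps.length) := Nat.mul_le_mul_left _ (by omega)
    rw [← hN]
    linarith

end

section

/-! ### The cost and the effect of an update -/

variable {m : ℕ} (p : Params m) {f : ℕ}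

/-- The function `b` bounds the counters below even after every pending decrement; it survives an
early stop, after which some decrements are not executed. At the level that triggers the rebuild it
is ≤ 0. -/
theorem wp_countDown (hf : 1 ≤ f) (ks : List ℕ) (hks : ks.Nodup) {σ : Store m} (h : σ.Wf f)
    (b : ℕ → ℝ) (hb : ∀ j, b j + (if j ∈ ks then 1 else 0) ≤ σ.counter j) :
    WP (countDown p ks) σ fun r τ T => τ.Wf f ∧ τ.next = σ.next ∧
      (∀ j, (∀ k ∈ r, k < j) → b j ≤ τ.counter j ∧ τ.kept j ⊆ σ.kept j) ∧
      (∀ k ∈ r, k ∈ ks ∧ b k ≤ 0 ∧ (∀ j ≤ k, τ.counter j = p.ε * ((τ.kept j).card : ℝ)) ∧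
        T ≤ 2 * ks.length + 100 * (f * (σ.kept k).card) + 50 * (k + 1)) ∧
      (r = none → T ≤ 2 * ks.length) := by
  induction ks generalizing σ with
  | nil =>
    refine WP.pure ⟨h, rfl, fun j _ => ⟨by simpa using hb j, subset_rfl⟩, by simp, by simp⟩
  | cons k ks ih =>
    have hk := List.nodup_cons.1 hks
    refine WP.query_bind (WP.act_bind ?_)
    set σ₁ := σ.setCounter k (σ.counter k - 1) with hσ₁
    have h1 : σ₁.Wf f := ⟨h.1, h.2, ⟨h.3.1, h.3.2, h.3.3⟩, h.4, h.5⟩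
    have hb1 : ∀ j, b j + (if j ∈ ks then 1 else 0) ≤ σ₁.counter j := by
      intro j
      change _ ≤ Function.update σ.counter k _ j
      have := hb j
      by_cases hjk : j = k
      · subst hjk
        simp only [List.mem_cons, true_or, if_true] at this
        rw [Function.update_self, if_neg hk.1]
        linarith
      · rw [Function.update_of_ne hjk]
        simpa [hjk] using this
    have hb2 : ∀ j, b j ≤ σ₁.counter j := fun j => by
      have := hb1 j
      split_ifs at this <;> linarith
    refine WP.ite (fun hx => ?_) fun _ => ?_
    · refine (wp_rebuild p hf k h1).seq ?_
      rintro _ τ T ⟨h2, h3, h4, h5, h6⟩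
      refine WP.pure ⟨h2, h3, fun j hj => ?_, ?_, by simp⟩
      · have := h4 j (hj k rfl)
        exact ⟨this.1 ▸ hb2 j, this.2⟩
      · rintro _ ⟨⟩
        have h7 := hb2 k
        rw [show σ₁.counter k = σ.counter k - 1 from Function.update_self ..] at h7
        refine ⟨by simp, h7.trans hx, h5, ?_⟩
        change T ≤ 100 * (f * (σ.kept k).card) + _ at h6
        simp only [List.length_cons]
        omega
    · refine (ih hk.2 h1 hb1).mono ?_
      rintro r τ T ⟨h2, h3, h4, h5, h6⟩
      simp only [List.length_cons]
      refine ⟨h2, h3, h4, fun j hj => ?_, fun hr => by have := h6 hr; omega⟩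
      obtain ⟨h7, h8, h9, h10⟩ := h5 j hj
      change T ≤ _ + 100 * (f * (σ.kept j).card) + _ at h10
      exact ⟨by simp [h7], h8, h9, by omega⟩

/-- How far the levels `≤ k` are from their last rebuild. -/
def excess (σ : Store m) (k : ℕ) : ℝ := ((σ.kept k).card : ℝ) - σ.counter k / p.ε

open Classical in
/-- The contribution of an update to the excess of the levels `≤ k`. -/
def load (u : Update m) (σ : Store m) (k : ℕ) : ℝ :=
  match u with
  | .insert F => if ∀ s ∈ F, σ.slevel s ≤ k then 1 else 0
  | .delete e => if σ.elevel e ≤ k then 1 + 1 / p.ε else 0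

/-- The effect and the cost of an update that takes the store from `σ` to `τ` in `T` steps; the
levels `≤ k` are rebuilt if `r = some k`. -/
structure UpdateSpec (f : ℕ) (u : Update m) (σ : Store m) (r : Option ℕ) (τ : Store m) (T : ℕ) :
    Prop where
  wf : τ.Wf f
  next : τ.next = match u with
    | .insert _ => σ.next + 1
    | .delete _ => σ.next
  above : ∀ j ≤ p.L, (∀ k ∈ r, k < j) → excess p τ j ≤ excess p σ j + load p u σ j
  level : ∀ k ∈ r, k ≤ p.L
  below : ∀ k ∈ r, ∀ j ≤ k, excess p τ j ≤ 0
  cost : ∀ k ∈ r, (T : ℝ) ≤ 55 * (p.L + 1) + 100 * f * (excess p σ k + load p u σ k)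
  cost_none : r = none → (T : ℝ) ≤ 55 * (p.L + 1) + 20 * f

theorem wp_deleteElement (hε : 0 < p.ε) (hf : 1 ≤ f) {σ : Store m} (h : σ.Wf f) {e : ℕ}
    (he : e < σ.next) :
    WP (deleteElement p e) σ fun r τ T => UpdateSpec p f (.delete e) σ r τ (1 + T) := by
  refine WP.query_bind (WP.act_bind ?_)
  set i := σ.elevel e with hi
  set σ₁ := σ.move e .dead i with hσ₁
  have h1 : σ₁.Wf f := ⟨h.1, h.2, h.lists.move he _ _, h.4, h.5⟩
  -- The invariant does not record that `e` was in a list before, so a possible growth by 1 is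
  -- allowed; this is the 1 in the load 1 + 1/ε.
  have hkept : ∀ j, ((σ₁.kept j).card : ℝ) ≤ (σ.kept j).card + if i ≤ j then 1 else 0 := by
    intro j
    split_ifs with hij
    · have : σ₁.kept j ⊆ insert e (σ.kept j) := by
        intro x hx
        obtain ⟨i', hi', st, hx⟩ := Store.mem_kept.1 hx
        rcases (h.lists.mem_move _ _ _ _ _ _).1 hx with ⟨rfl, -, -⟩ | hx
        · simp
        · exact Finset.mem_insert_of_mem (Store.mem_kept.2 ⟨i', hi', st, hx.1⟩)
      exact_mod_cast (Finset.card_le_card this).trans (Finset.card_insert_le _ _)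
    · have : σ₁.kept j ⊆ σ.kept j := by
        intro x hx
        obtain ⟨i', hi', st, hx⟩ := Store.mem_kept.1 hx
        rcases (h.lists.mem_move _ _ _ _ _ _).1 hx with ⟨-, -, rfl⟩ | hx
        · omega
        · exact Store.mem_kept.2 ⟨i', hi', st, hx.1⟩
      simpa using Finset.card_le_card this
  have hmem : ∀ j, j ∈ (List.range' i (p.L + 1 - i)).reverse ↔ i ≤ j ∧ j ≤ p.L := by
    intro j
    rw [List.mem_reverse, List.mem_range'_1]
    omega
  refine (wp_countDown p hf _ (List.nodup_reverse.2 List.nodup_range') h1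
    (fun j => σ.counter j - if i ≤ j ∧ j ≤ p.L then 1 else 0) fun j => ?_).mono ?_
  · simp only [hmem]
    change _ ≤ σ.counter j
    linarith
  rintro r τ T ⟨h2, h3, h4, h5, h6⟩
  simp only [List.length_reverse, List.length_range'] at h5 h6
  refine ⟨h2, h3, fun j hj hjr => ?_, fun k hk => ((hmem k).1 (h5 k hk).1).2,
    fun k hk j hj => ?_, fun k hk => ?_, fun hr => ?_⟩
  · obtain ⟨h7, h8⟩ := h4 j hjr
    have h9 : ((τ.kept j).card : ℝ) ≤ (σ₁.kept j).card := by exact_mod_cast Finset.card_le_card h8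
    have h10 := hkept j
    have h11 := div_le_div_of_nonneg_right h7 hε.le
    simp only [excess, load]
    change _ ≤ _ + if i ≤ j then _ else _
    split_ifs at h10 ⊢ with hij
    · rw [if_pos ⟨hij, hj⟩, sub_div] at h11
      linarith
    · rw [if_neg (by tauto), sub_zero] at h11
      linarith
  · rw [excess, (h5 k hk).2.2.1 j hj, mul_div_cancel_left₀ _ hε.ne']
    simp
  · obtain ⟨h7, h8, -, h9⟩ := h5 k hk
    have hik := (hmem k).1 h7
    have h10 := hkept k
    rw [if_pos hik, sub_nonpos] at h8
    rw [if_pos hik.1] at h10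
    have h11 := div_le_div_of_nonneg_right h8 hε.le
    have h12 : load p (.delete e) σ k = 1 + 1 / p.ε := if_pos hik.1
    -- The counter was at most 1 before its decrement, so the term that the excess subtracts is at
    -- most the 1/ε contained in the load.
    have h13 : ((σ₁.kept k).card : ℝ) ≤ excess p σ k + load p (.delete e) σ k := by
      rw [h12, excess]
      linarith
    have h14 : (1 + (1 + (1 + T))) ≤ 55 * (p.L + 1) + 100 * (f * (σ₁.kept k).card) := by omega
    have h15 : ((1 + (1 + (1 + T)) : ℕ) : ℝ) ≤
        55 * (p.L + 1) + 100 * (f * ((σ₁.kept k).card : ℝ)) := by exact_mod_cast h14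
    have h16 := mul_le_mul_of_nonneg_left h13 (Nat.cast_nonneg (α := ℝ) f)
    linarith
  · have := h6 hr
    have h14 : (1 + (1 + (1 + T))) ≤ 55 * (p.L + 1) + 20 * f := by omega
    exact_mod_cast h14

theorem wp_insertElement (hf : 1 ≤ f) {σ : Store m} (h : σ.Wf f) {F : List (Fin m)}
    (hF : F.length ≤ f) :
    WP (insertElement p F) σ fun r τ T => UpdateSpec p f (.insert F) σ r τ (1 + T) := by
  refine WP.query_bind (WP.act_bind ?_)
  refine WP.seq (WP.each_le (fun l τ => ∃ G : ℕ → List (Fin m),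
    τ = { σ with next := σ.next + 1, sets := G } ∧ (∀ e, e ≠ σ.next → G e = σ.sets e) ∧
    (G σ.next).length + l.length ≤ F.length) 1 ⟨σ.sets, rfl, fun _ _ => rfl, ?_⟩ ?_) ?_
  · simp [h.fresh]
  · rintro s l _ - ⟨G, rfl, hG, hl⟩
    refine WP.act ⟨⟨Function.update G σ.next (s :: G σ.next), rfl, fun e he => ?_, ?_⟩, le_rfl⟩
    · rw [Function.update_of_ne he, hG e he]
    · rw [Function.update_self]
      simp only [List.length_cons] at hl ⊢
      omega
  rintro _ _ T₁ ⟨⟨G, rfl, hG, hl⟩, hT₁⟩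
  set σ₁ : Store m := { σ with next := σ.next + 1, sets := G } with hσ₁
  refine (wp_maxLevel F).seq ?_
  rintro i _ T₂ ⟨rfl, hT₂, hi⟩
  have h1 : σ₁.ListsOk := ⟨h.3.1, h.3.2, fun he => (h.3.3 he).trans (Nat.lt_succ_self _)⟩
  set σ₂ := σ₁.link σ.next .passive i with hσ₂
  -- Both branches of the insertion end in a store that differs from `σ₂` only in weights, cover and
  -- report.
  have key : ∀ {τ : Store m}, τ.core = σ₂.core → τ.found = σ.found → τ.setAlive = σ.setAlive →
      ∀ {T : ℕ}, T ≤ 20 * f → UpdateSpec p f (.insert F) σ none τ T := by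
    intro τ hτ hfd hal T hT
    simp only [Store.core, Prod.mk.injEq] at hτ
    obtain ⟨e1, e2, e3, e4, e5, e6⟩ := hτ
    have h2 : σ₂.ListsOk := h1.link (fun st i' he => (h.lists.lt he).false)
      (Nat.lt_succ_self _) _ _
    refine ⟨⟨fun e => ?_, fun e he => ?_, ⟨?_, ?_, ?_⟩, hfd.trans h.4, hal.trans h.5⟩, e1,
      fun j _ _ => ?_, by simp, by simp, by simp, fun _ => ?_⟩
    · rw [e2]
      change (G e).length ≤ f
      by_cases hen : e = σ.next
      · rw [hen]
        omega
      · rw [hG e hen]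
        exact h.1 e
    · rw [e1] at he
      rw [e2]
      have : σ.next + 1 ≤ e := he
      exact (hG e (by omega)).trans (h.2 e (by omega))
    · rw [e6]; exact h2.nodup
    · rw [e6, e4, e5]; exact h2.loc
    · rw [e6, e1]; exact h2.lt
    · have hk : τ.kept j = σ₂.kept j := by simp only [Store.kept, e6]
      have hc : τ.counter j = σ.counter j := by rw [e3]; rfl
      have hmem : ∀ x, x ∈ σ₂.kept j → x ∈ σ.kept j ∨ (x = σ.next ∧ i ≤ j) := by
        intro x hx
        obtain ⟨i', hi', st, hx⟩ := Store.mem_kept.1 hx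
        rcases (Store.mem_link _ _ _ _ _ _).1 hx with ⟨rfl, -, rfl⟩ | hx
        · exact Or.inr ⟨rfl, hi'⟩
        · exact Or.inl (Store.mem_kept.2 ⟨i', hi', st, hx⟩)
      have hcard : ((σ₂.kept j).card : ℝ) ≤ (σ.kept j).card + load p (.insert F) σ j := by
        simp only [load]
        split_ifs with hj
        · have : σ₂.kept j ⊆ insert σ.next (σ.kept j) := by
            intro x hx
            rcases hmem x hx with hx | ⟨rfl, -⟩ <;> simp [*]
          exact_mod_cast (Finset.card_le_card this).trans (Finset.card_insert_le _ _)
        · have : σ₂.kept j ⊆ σ.kept j := by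
            intro x hx
            exact (hmem x hx).resolve_right fun h' => hj ((hi j).1 h'.2)
          simpa using Finset.card_le_card this
      simp only [excess, hk, hc]
      linarith
    · have : T ≤ 55 * (p.L + 1) + 20 * f := by omega
      exact_mod_cast this
  refine (wp_foldLoop_query _ F false).seq ?_
  rintro b _ T₃ ⟨rfl, hT₃⟩
  refine WP.ite (fun _ => ?_) fun _ => ?_
  · refine WP.act_bind (WP.act_bind (WP.pure (key ?_ ?_ ?_ ?_)))
    exacts [rfl, rfl, rfl, by omega]
  · refine (wp_leastSlack p F).seq ?_
    rintro x _ T₄ ⟨rfl, hT₄⟩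
    refine WP.act_bind (WP.act_bind (WP.seq (WP.each_const (fun τ => τ.core = σ₂.core ∧
      τ.found = σ.found ∧ τ.setAlive = σ.setAlive) 1 ⟨rfl, rfl, rfl⟩ ?_) ?_))
    · exact fun s τ _ hτ => WP.act ⟨⟨hτ.1, hτ.2.1, hτ.2.2⟩, le_rfl⟩
    · rintro _ τ T₅ ⟨⟨h2, h3, h4⟩, hT₅⟩
      exact WP.pure (key h2 h3 h4 (by omega))

theorem wp_process (hε : 0 < p.ε) (hf : 1 ≤ f) {σ : Store m} (h : σ.Wf f) {u : Update m}
    (hi : ∀ F, u = .insert F → F.length ≤ f) (hd : ∀ e, u = .delete e → e < σ.next) :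
    WP (process p u) σ fun r τ T => UpdateSpec p f u σ r τ T := by
  have h' : σ.clearReport.Wf f := ⟨h.1, h.2, ⟨h.3.1, h.3.2, h.3.3⟩, h.4, h.5⟩
  cases u with
  | insert F =>
    refine WP.act_bind ((wp_insertElement p hf h' (hi F rfl)).mono fun r τ T hs => ?_)
    exact ⟨hs.1, hs.2, hs.3, hs.4, hs.5, hs.6, hs.7⟩
  | delete e =>
    refine WP.act_bind ((wp_deleteElement p hε hf h' (hd e rfl)).mono fun r τ T hs => ?_)
    exact ⟨hs.1, hs.2, hs.3, hs.4, hs.5, hs.6, hs.7⟩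

end

section

/-! ### Sequences of updates -/

variable {m : ℕ} (p : Params m) {f : ℕ}

theorem Store.wf_init (f : ℕ) : (Store.init m).Wf f where
  sets_le _ := Nat.zero_le _
  fresh _ _ := rfl
  lists := ⟨fun _ _ => List.nodup_nil, fun h => absurd h List.not_mem_nil,
    fun h => absurd h List.not_mem_nil⟩
  found := rfl
  alive := rfl

theorem excess_init (k : ℕ) : excess p (Store.init m) k = 0 := by
  have h1 : (Store.init m).kept k = ∅ := by
    refine Finset.eq_empty_of_forall_notMem fun x hx => ?_
    obtain ⟨_, _, _, h⟩ := Store.mem_kept.1 hx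
    exact absurd h List.not_mem_nil
  have h2 : (Store.init m).counter k = 0 := rfl
  simp [excess, h1, h2]

/-- `processAll` peels off the first update, whereas the inductions over time need the last one. -/
theorem processAll_concat (us : List (Update m)) (u : Update m) (σ : Store m) :
    (processAll p (us ++ [u]) σ).2.1 = (process p u (processAll p us σ).2.1).2.1 ∧
    (processAll p (us ++ [u]) σ).2.2 =
      (processAll p us σ).2.2 + (process p u (processAll p us σ).2.1).2.2 := by
  induction us generalizing σ with
  | nil =>
    refine ⟨rfl, ?_⟩
    change (process p u σ).2.2 + 0 = 0 + (process p u σ).2.2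
    rw [add_zero, zero_add]
  | cons v us ih =>
    obtain ⟨h1, h2⟩ := ih (process p v σ).2.1
    refine ⟨h1, ?_⟩
    change (process p v σ).2.2 + (processAll p (us ++ [u]) (process p v σ).2.1).2.2 =
      (process p v σ).2.2 + (processAll p us (process p v σ).2.1).2.2 + _
    rw [h2, add_assoc]
    rfl

variable {us : List (Update m)} {t : ℕ}

theorem storeBefore_succ (ht : t < us.length) :
    storeBefore p us (t + 1) = (process p us[t] (storeBefore p us t)).2.1 := by
  rw [storeBefore, List.take_succ_eq_append_getElem ht, (processAll_concat p _ _ _).1]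
  rfl

theorem totalTime_succ (ht : t < us.length) :
    totalTime p (us.take (t + 1)) = totalTime p (us.take t) + updateTime p us t := by
  rw [totalTime, List.take_succ_eq_append_getElem ht, (processAll_concat p _ _ _).2, updateTime,
    List.getElem?_eq_getElem ht]
  rfl

theorem present_succ (ht : t < us.length) :
    present (us.take (t + 1)) = match us[t] with
      | .insert _ => ((present (us.take t)).1 + 1,
          insert (present (us.take t)).1 (present (us.take t)).2)
      | .delete e => ((present (us.take t)).1, (present (us.take t)).2.erase e) := by
  rw [present, List.take_succ_eq_append_getElem ht, List.foldl_append]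
  rfl

/-- The first update cannot be a deletion, and an inserted element lies in at least one and at most
`f` sets. -/
theorem Legal.one_le {n : ℕ} (h : Legal f n us) (hus : us ≠ []) : 1 ≤ f := by
  obtain ⟨u, us', rfl⟩ := List.exists_cons_of_ne_nil hus
  cases u with
  | insert F =>
    obtain ⟨h1, -, h2⟩ := h.insert_ok F (by simp)
    exact (List.length_pos_of_ne_nil h1).trans_le h2
  | delete e => simpa [present] using h.delete_ok 0 e rfl

/-- The invariant holds before every update, and every update has the specified effect and cost. -/
theorem Legal.updateSpec {n : ℕ} (h : Legal f n us) (hε : 0 < p.ε) (ht : t < us.length) :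
    ∃ T : ℕ, updateTime p us t = T ∧
      UpdateSpec p f us[t] (storeBefore p us t) (rebuildLevel p us t)
        (storeBefore p us (t + 1)) T := by
  have hf := h.one_le (List.ne_nil_of_length_pos (Nat.zero_lt_of_lt ht))
  have step : ∀ t (ht : t < us.length), (storeBefore p us t).Wf f →
      (∀ e ∈ (present (us.take t)).2, e < (storeBefore p us t).next) → ∃ T : ℕ,
      updateTime p us t = T ∧ UpdateSpec p f us[t] (storeBefore p us t) (rebuildLevel p us t)
        (storeBefore p us (t + 1)) T := by
    intro t ht hwf hp
    obtain ⟨T, hT, hs⟩ := wp_process p hε hf hwf (u := us[t])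
      (fun F hF => (h.insert_ok F (hF ▸ List.getElem_mem ht)).2.2)
      (fun e he => hp e (h.delete_ok t e (by rw [List.getElem?_eq_getElem ht, he])))
    refine ⟨T, ?_, ?_⟩
    · rw [updateTime, List.getElem?_eq_getElem ht]
      exact hT
    · rw [rebuildLevel, List.getElem?_eq_getElem ht, storeBefore_succ p ht]
      exact hs
  -- The name counter equals the number of insertions and exceeds all present names; hence a legally
  -- deleted element has a name below `next`.
  suffices H : ∀ t ≤ us.length, (storeBefore p us t).Wf f ∧
      (storeBefore p us t).next = (present (us.take t)).1 ∧
      ∀ e ∈ (present (us.take t)).2, e < (present (us.take t)).1 by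
    obtain ⟨h1, h2, h3⟩ := H t ht.le
    exact step t ht h1 (h2 ▸ h3)
  intro t
  induction t with
  | zero => exact fun _ => ⟨Store.wf_init f, rfl, by simp [present]⟩
  | succ t ih =>
    intro ht
    obtain ⟨h1, h2, h3⟩ := ih (by omega)
    obtain ⟨T, -, hs⟩ := step t ht h1 (h2 ▸ h3)
    have hn := hs.next
    refine ⟨hs.wf, ?_, ?_⟩
    · rw [present_succ ht, hn]
      cases us[t] <;> simp [h2]
    · rw [present_succ ht]
      cases us[t] with
      | insert F =>
        simp only [Finset.mem_insert, forall_eq_or_imp]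
        exact ⟨Nat.lt_succ_self _, fun e he => (h3 e he).trans (Nat.lt_succ_self _)⟩
      | delete e =>
        exact fun x hx => h3 x (Finset.mem_of_mem_erase hx)

theorem load_le (hε : 0 < p.ε) (u : Update m) (σ : Store m) (k : ℕ) :
    load p u σ k ≤ 1 + 1 / p.ε := by
  have : 0 < 1 / p.ε := by positivity
  cases u <;> simp only [load] <;> split_ifs <;> linarith

/-! ### The updates since the last rebuild -/

open Classical in
/-- The number of updates since the last rebuild that have a given property. -/
theorem ncard_window_succ (P : ℕ → Prop) (k t : ℕ) :
    (if ∃ j ∈ rebuildLevel p us t, k ≤ j then 0 else {i ∈ window p us k t | P i}.ncard) +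
      (if P (t + 1) then 1 else 0) ≤ {i ∈ window p us k (t + 1) | P i}.ncard := by
  have hfin : ∀ t, {i ∈ window p us k t | P i}.Finite := fun t =>
    (Set.finite_Iic t).subset fun i hi => hi.1.1
  have hsub : (¬ ∃ j ∈ rebuildLevel p us t, k ≤ j) →
      {i ∈ window p us k t | P i} ⊆ {i ∈ window p us k (t + 1) | P i} := by
    rintro hr i ⟨⟨h1, h2⟩, h3⟩
    refine ⟨⟨by omega, fun r hir hrt j hj => ?_⟩, h3⟩
    rcases Nat.lt_succ_iff_lt_or_eq.1 hrt with hrt | rfl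
    · exact h2 r hir hrt j hj
    · by_contra hkj
      exact hr ⟨j, hj, not_lt.1 hkj⟩
  have hmem : P (t + 1) → t + 1 ∈ {i ∈ window p us k (t + 1) | P i} := fun hP =>
    ⟨⟨le_rfl, fun r _ _ => by omega⟩, hP⟩
  -- After a rebuild that reaches level k, only the new update is counted; otherwise the old window
  -- is contained in the new one.
  split_ifs with h1 h2 h2
  · exact (Set.ncard_pos (hfin _)).2 ⟨_, hmem h2⟩
  · omega
  · rw [← Set.ncard_insert_of_notMem (fun h => absurd h.1.1 (Nat.not_succ_le_self t)) (hfin t)]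
    exact Set.ncard_le_ncard (Set.insert_subset (hmem h2) (hsub h1)) (hfin _)
  · exact Set.ncard_le_ncard (hsub h1) (hfin _)

open Classical in
theorem load_le_indicator (hε : 0 < p.ε) (ht : t < us.length) (k : ℕ) :
    load p us[t] (storeBefore p us t) k ≤
      (1 + 1 / p.ε) * ((if DeletesAtMost p us k t then 1 else 0 : ℕ) : ℝ) +
        ((if InsertsAtMost p us k t then 1 else 0 : ℕ) : ℝ) := by
  have hpos : 0 < 1 + 1 / p.ε := by positivity
  have hnn : 0 ≤ (1 + 1 / p.ε) * ((if DeletesAtMost p us k t then 1 else 0 : ℕ) : ℝ) := by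
    positivity
  have hnn' : (0 : ℝ) ≤ ((if InsertsAtMost p us k t then 1 else 0 : ℕ) : ℝ) := Nat.cast_nonneg _
  cases hu : us[t] with
  | insert F =>
    by_cases hF : ∀ s ∈ F, (storeBefore p us t).slevel s ≤ k
    · have h1 : load p (.insert F) (storeBefore p us t) k = 1 := if_pos hF
      have h2 : InsertsAtMost p us k t := ⟨F, by rw [List.getElem?_eq_getElem ht, hu], hF⟩
      rw [h1, if_pos h2, Nat.cast_one]
      linarith
    · have h1 : load p (.insert F) (storeBefore p us t) k = 0 := if_neg hF
      linarith
  | delete e =>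
    by_cases he : (storeBefore p us t).elevel e ≤ k
    · have h1 : load p (.delete e) (storeBefore p us t) k = 1 + 1 / p.ε := if_pos he
      have h2 : DeletesAtMost p us k t := ⟨e, by rw [List.getElem?_eq_getElem ht, hu], he⟩
      rw [h1, if_pos h2, Nat.cast_one]
      linarith
    · have h1 : load p (.delete e) (storeBefore p us t) k = 0 := if_neg he
      linarith

/-- The excess is paid for by the updates since the last rebuild. -/
theorem Legal.excess_add_load_le {n : ℕ} (h : Legal f n us) (hε : 0 < p.ε) {k : ℕ}
    (hk : k ≤ p.L) (ht : t < us.length) :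
    excess p (storeBefore p us t) k + load p us[t] (storeBefore p us t) k ≤
      (1 + 1 / p.ε) * ({i ∈ window p us k t | DeletesAtMost p us k i}.ncard : ℝ) +
        ({i ∈ window p us k t | InsertsAtMost p us k i}.ncard : ℝ) := by
  classical
  have hpos : 0 < 1 + 1 / p.ε := by positivity
  have hl := load_le_indicator p hε ht k
  induction t with
  | zero =>
    have key : ∀ P : ℕ → Prop, (if P 0 then 1 else 0) ≤ {i ∈ window p us k 0 | P i}.ncard := by
      intro P
      split_ifs with hP
      · exact (Set.ncard_pos ((Set.finite_Iic 0).subset fun i hi => hi.1.1)).2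
          ⟨0, ⟨le_rfl, fun r _ _ => by omega⟩, hP⟩
      · omega
    have h1 : ((if DeletesAtMost p us k 0 then 1 else 0 : ℕ) : ℝ) ≤ _ :=
      Nat.cast_le.2 (key (DeletesAtMost p us k))
    have h2 : ((if InsertsAtMost p us k 0 then 1 else 0 : ℕ) : ℝ) ≤ _ :=
      Nat.cast_le.2 (key (InsertsAtMost p us k))
    have h3 := mul_le_mul_of_nonneg_left h1 hpos.le
    have h4 : excess p (storeBefore p us 0) k = 0 := excess_init p k
    linarith
  | succ t ih =>
    have ht' : t < us.length := by omega
    have ih := ih ht' (load_le_indicator p hε ht' k)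
    obtain ⟨T, -, hs⟩ := h.updateSpec p hε ht'
    have h1 := ncard_window_succ p (us := us) (DeletesAtMost p us k) k t
    have h2 := ncard_window_succ p (us := us) (InsertsAtMost p us k) k t
    have h1' := mul_le_mul_of_nonneg_left (Nat.cast_le (α := ℝ).2 h1) hpos.le
    have h2' := Nat.cast_le (α := ℝ).2 h2
    rw [Nat.cast_add] at h1' h2'
    rw [mul_add] at h1'
    -- A rebuild of the levels ≤ j with j ≥ k leaves an excess ≤ 0, so the current load alone
    -- counts; otherwise the excess has grown by at most the previous load.
    by_cases hr : ∃ j ∈ rebuildLevel p us t, k ≤ j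
    · rw [if_pos hr, Nat.cast_zero] at h1' h2'
      obtain ⟨j, hj, hkj⟩ := hr
      have := hs.below j hj k hkj
      linarith
    · rw [if_neg hr] at h1' h2'
      have := hs.above k hk fun j hj => not_le.1 fun hkj => hr ⟨j, hj, hkj⟩
      linarith

/-! ### The amortized running time -/

/-- The potential function of the amortized analysis. -/
def totalExcess (σ : Store m) : ℝ := ∑ j ∈ Finset.range (p.L + 1), max 0 (excess p σ j)

/-- The factor 100 f of the potential is the price of a rebuild per unit of excess in
`UpdateSpec.cost`. -/
theorem UpdateSpec.cost_add_le (hε : 0 < p.ε) {u : Update m} {σ τ : Store m} {r : Option ℕ}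
    {T : ℕ} (h : UpdateSpec p f u σ r τ T) :
    (T : ℝ) + 100 * f * totalExcess p τ ≤ 100 * f * totalExcess p σ +
      (55 * (p.L + 1) + 20 * f + 100 * f * ((p.L + 1) * (1 + 1 / p.ε))) := by
  have hpos : 0 < 1 + 1 / p.ε := by positivity
  have hload := load_le p hε u σ
  have hf : (0 : ℝ) ≤ 100 * f := by positivity
  have hstep : ∀ j ∈ Finset.range (p.L + 1), max 0 (excess p τ j) ≤
      max 0 (excess p σ j) + (1 + 1 / p.ε) := by
    intro j hj
    have hj := Nat.lt_succ_iff.1 (Finset.mem_range.1 hj)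
    have h0 := le_max_left 0 (excess p σ j)
    refine max_le (by linarith) ?_
    by_cases hr : ∀ k ∈ r, k < j
    · linarith [h.above j hj hr, hload j, le_max_right 0 (excess p σ j)]
    · push Not at hr
      obtain ⟨k, hk, hjk⟩ := hr
      linarith [h.below k hk j hjk]
  cases hr : r with
  | none =>
    have hsum := Finset.sum_le_sum hstep
    rw [Finset.sum_add_distrib, Finset.sum_const, Finset.card_range, nsmul_eq_mul] at hsum
    push_cast at hsum
    have h1 := mul_le_mul_of_nonneg_left hsum hf
    have h2 := h.cost_none hr
    rw [totalExcess, totalExcess]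
    linarith
  | some k =>
    have hk : k ∈ r := hr
    have hkL := h.level k hk
    -- The term of level k is 0 after the rebuild, so its old value and its allowance 1 + 1/ε are
    -- both free; together they dominate excess plus load in the cost.
    have hsum : ∑ j ∈ Finset.range (p.L + 1), (max 0 (excess p τ j) +
        if j = k then max 0 (excess p σ k) + (1 + 1 / p.ε) else 0) ≤
        ∑ j ∈ Finset.range (p.L + 1), (max 0 (excess p σ j) + (1 + 1 / p.ε)) := by
      refine Finset.sum_le_sum fun j hj => ?_
      split_ifs with hjk
      · subst hjk
        rw [max_eq_left (h.below j hk j le_rfl), zero_add]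
      · rw [add_zero]
        exact hstep j hj
    rw [Finset.sum_add_distrib, Finset.sum_add_distrib, Finset.sum_const, Finset.card_range,
      nsmul_eq_mul, Finset.sum_ite_eq', if_pos (Finset.mem_range.2 (by omega))] at hsum
    push_cast at hsum
    have h1 := mul_le_mul_of_nonneg_left hsum hf
    have h2 := h.cost k hk
    have h3 : excess p σ k + load p u σ k ≤ max 0 (excess p σ k) + (1 + 1 / p.ε) :=
      add_le_add (le_max_right _ _) (hload k)
    have h4 := mul_le_mul_of_nonneg_left h3 hf
    rw [totalExcess, totalExcess]
    have : (0 : ℝ) ≤ 20 * f := by positivity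
    linarith

theorem Legal.totalTime_le {n : ℕ} (h : Legal f n us) (hε : 0 < p.ε) (ht : t ≤ us.length) :
    ∃ T : ℕ, totalTime p (us.take t) = T ∧
      (T : ℝ) ≤ t * (55 * (p.L + 1) + 20 * f + 100 * f * ((p.L + 1) * (1 + 1 / p.ε))) := by
  suffices H : ∃ T : ℕ, totalTime p (us.take t) = T ∧
      (T : ℝ) + 100 * f * totalExcess p (storeBefore p us t) ≤
        t * (55 * (p.L + 1) + 20 * f + 100 * f * ((p.L + 1) * (1 + 1 / p.ε))) by
    obtain ⟨T, hT, hle⟩ := H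
    have : 0 ≤ totalExcess p (storeBefore p us t) :=
      Finset.sum_nonneg fun _ _ => le_max_left _ _
    have : 0 ≤ 100 * f * totalExcess p (storeBefore p us t) := by positivity
    exact ⟨T, hT, by linarith⟩
  induction t with
  | zero =>
    have h0 : ∀ j, excess p (storeBefore p us 0) j = 0 := excess_init p
    exact ⟨0, rfl, by simp [totalExcess, h0]⟩
  | succ t ih =>
    obtain ⟨T, hT, hle⟩ := ih (by omega)
    obtain ⟨T', hT', hs⟩ := h.updateSpec p hε ht
    refine ⟨T + T', ?_, ?_⟩
    · rw [totalTime_succ p ht, hT, hT']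
      push_cast
      rfl
    · have := hs.cost_add_le p hε
      push_cast
      linarith

/-! ### The number of levels -/

variable {p}

/-- From log x ≥ 1 - 1/x: log(1+ε) ≥ ε/(1+ε), and 1 + ε < 3/2. -/
theorem Params.two_thirds_mul_le_log (hε : 0 < p.ε) (hε' : p.ε < 1 / 2) :
    2 / 3 * p.ε ≤ Real.log (1 + p.ε) := by
  refine le_trans ?_ (Real.one_sub_inv_le_log_of_pos (by linarith))
  rw [le_sub_iff_add_le, ← le_sub_iff_add_le', inv_le_iff_one_le_mul₀ (by linarith)]
  nlinarith

/-- This lower bound lets additive constants be absorbed into log(Cn)/ε. -/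
theorem Params.two_thirds_le (hε : 0 < p.ε) (hε' : p.ε < 1 / 2) (h : 1 + p.ε ≤ p.C * p.n) :
    2 / 3 ≤ Real.log (p.C * p.n) / p.ε := by
  rw [le_div_iff₀ hε]
  exact (Params.two_thirds_mul_le_log hε hε').trans (Real.log_le_log (by linarith) h)

/-- With Λ = log(Cn)/ε ≥ 2/3, L + 1 is at most the logarithm to base 1+ε plus 3, that is at most
3Λ/2 + 9Λ/2. -/
theorem Params.L_add_one_le (hε : 0 < p.ε) (hε' : p.ε < 1 / 2) (h : 1 + p.ε ≤ p.C * p.n) :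
    (p.L : ℝ) + 1 ≤ 6 * (Real.log (p.C * p.n) / p.ε) := by
  have h1 := Params.two_thirds_mul_le_log hε hε'
  have h2 : 0 < Real.log (1 + p.ε) := by linarith
  have h3 := Params.two_thirds_le hε hε' h
  have h4 : Real.logb (1 + p.ε) (p.C * p.n) ≤ 3 / 2 * (Real.log (p.C * p.n) / p.ε) := by
    rw [Real.logb, div_le_iff₀ h2]
    have := mul_le_mul_of_nonneg_left h1
      (show 0 ≤ 3 / 2 * (Real.log (p.C * p.n) / p.ε) by linarith)
    refine le_trans (le_of_eq ?_) this
    field_simp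
  have h5 : (⌈Real.logb (1 + p.ε) (p.C * p.n)⌉₊ : ℝ) < Real.logb (1 + p.ε) (p.C * p.n) + 1 := by
    refine Nat.ceil_lt_add_one ?_
    exact div_nonneg (h2.le.trans (Real.log_le_log (by linarith) h)) h2.le
  rw [Params.L]
  push_cast
  linarith

end

end DynamicSetCover

end

/-! ### The theorem: collecting the constants -/

theorem theorem4p5 :
    ∃ K : ℝ, 0 < K ∧
      ∀ (m : ℕ) (p : DynamicSetCover.Params m) (f : ℕ) (us : List (DynamicSetCover.Update m)),
        0 < p.ε → p.ε < 1 / 2 → 1 ≤ p.C →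
        (∀ s, 1 / p.C ≤ p.cost s ∧ p.cost s ≤ 1) →
        1 + p.ε ≤ p.C * p.n →
        DynamicSetCover.Legal f p.n us →
        -- amortized update time
        (∀ t ≤ us.length, ∃ T : ℕ, DynamicSetCover.totalTime p (us.take t) = T ∧
          (T : ℝ) ≤ K * (f * Real.log (p.C * p.n) / p.ε ^ 2) * t) ∧
        -- number of levels
        (p.L : ℝ) ≤ K * (Real.log (p.C * p.n) / p.ε) ∧
        -- the cost of the individual rebuilds
        (∀ t k, DynamicSetCover.rebuildLevel p us t = some k →
          k ≤ p.L ∧ ∃ T : ℕ, DynamicSetCover.updateTime p us t = T ∧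
            (T : ℝ) ≤ K * (f / p.ε *
                ({i ∈ DynamicSetCover.window p us k t |
                  DynamicSetCover.DeletesAtMost p us k i}.ncard : ℝ) +
              f * ({i ∈ DynamicSetCover.window p us k t |
                  DynamicSetCover.InsertsAtMost p us k i}.ncard : ℝ) +
              Real.log (p.C * p.n) / p.ε)) := by
  -- A generous choice: the amortized bound needs 165 + 20 + 900, and a single rebuild needs 330 for
  -- the levels, 150 for deletions and 100 for insertions.
  refine ⟨2000, by norm_num, ?_⟩
  intro m p f us hε hε' _ _ hCn hlegal
  have hL := DynamicSetCover.Params.L_add_one_le hε hε' hCn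
  have hΛ := DynamicSetCover.Params.two_thirds_le hε hε' hCn
  set Λ := Real.log (p.C * p.n) / p.ε with hΛdef
  refine ⟨fun t ht => ?_, by linarith, fun t k hk => ?_⟩
  -- The case t = 0 is separate because f ≥ 1 is only available for a nonempty sequence.
  · rcases Nat.eq_zero_or_pos t with rfl | ht0
    · exact ⟨0, rfl, by simp⟩
    obtain ⟨T, hT, hle⟩ := hlegal.totalTime_le p hε ht
    refine ⟨T, hT, hle.trans ?_⟩
    rw [mul_comm]
    refine mul_le_mul_of_nonneg_right ?_ (Nat.cast_nonneg t)
    have hf : (1 : ℝ) ≤ f := by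
      exact_mod_cast hlegal.one_le (List.ne_nil_of_length_pos (by omega))
    have hx : 2 ≤ 1 / p.ε := by
      rw [le_div_iff₀ hε]
      linarith
    have heq : f * Real.log (p.C * p.n) / p.ε ^ 2 = f * (Λ * (1 / p.ε)) := by
      rw [hΛdef]
      field_simp
    rw [heq]
    generalize 1 / p.ε = x at *
    have h1 : 2 * Λ ≤ Λ * x := by nlinarith
    have h2 : Λ * x ≤ f * (Λ * x) := le_mul_of_one_le_left (by nlinarith) hf
    have h3 : (f : ℝ) * 1 ≤ f * (Λ * x) := mul_le_mul_of_nonneg_left (by linarith) (by linarith)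
    -- Here x = 1/ε ≥ 2, so 1 + x ≤ 3x/2.
    have h4 : ((p.L : ℝ) + 1) * (1 + x) ≤ 6 * Λ * (3 / 2 * x) :=
      mul_le_mul hL (by linarith) (by linarith) (by linarith)
    have h5 := mul_le_mul_of_nonneg_left h4 (show (0 : ℝ) ≤ f by linarith)
    linarith
  · have ht : t < us.length := by
      by_contra ht
      rw [DynamicSetCover.rebuildLevel, List.getElem?_eq_none (not_lt.1 ht)] at hk
      cases hk
    obtain ⟨T, hT, hs⟩ := hlegal.updateSpec p hε ht
    have hkL := hs.level k hk
    refine ⟨hkL, T, hT, (hs.cost k hk).trans ?_⟩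
    have h1 := hlegal.excess_add_load_le p hε hkL ht
    have hx : 2 ≤ 1 / p.ε := by
      rw [le_div_iff₀ hε]
      linarith
    rw [div_eq_mul_one_div (f : ℝ) p.ε]
    set d := {i ∈ DynamicSetCover.window p us k t | DynamicSetCover.DeletesAtMost p us k i}.ncard
    set i := {i ∈ DynamicSetCover.window p us k t | DynamicSetCover.InsertsAtMost p us k i}.ncard
    generalize 1 / p.ε = x at *
    have h2 := mul_le_mul_of_nonneg_left h1 (Nat.cast_nonneg (α := ℝ) f)
    have hfd : 0 ≤ (f : ℝ) * d := by positivity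
    have hfi : 0 ≤ (f : ℝ) * i := by positivity
    have h3 : 2 * ((f : ℝ) * d) ≤ f * x * d := by nlinarith
    linarith
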